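/- Let $\mathcal H=\ell^2(\mathbb N)$ be the Hilbert space of one bosonic mode, with Fock basis $\{|k\rangle\}_{k\ge 0}$, and let $\mathcal H\otimes\mathcal H_E=\ell^2(\mathbb N\times\mathbb N)$ be that of a system mode and an environment mode, with basis $|n_1,n_2\rangle$ (the environment is the second mode). Let $\sqrt{\cdot}$ denote the nonnegative square root, let $\delta$ be the Kronecker symbol and let $0^0=1$. For $m_1,m_2,n_1,n_2\in\mathbb N$ put: * (attenuator, beamsplitter, $0\le\kappa\le1$) $$T[\mathcal B(\kappa)]^{m_1,m_2}_{n_1,n_2}=\sqrt{\tfrac{m_1!\,m_2!}{n_1!\,n_2!}}\sum_{r=0}^{n_1}\sum_{j=0}^{n_2}\binom{n_1}{r}\binom{n_2}{j}(-1)^{n_2-j}\kappa^{n_1-r+j}\big(\sqrt{1-\kappa^2}\big)^{r+n_2-j}\,\delta_{m_2,r+j}\,\delta_{m_1,n_1+n_2-r-j};$$ * (amplifier, two-mode squeezer, $\kappa\ge1$) $$T[\mathcal A(\kappa)]^{m_1,m_2}_{n_1,n_2}=\kappa^{-1}\sqrt{\tfrac{n_1!\,m_2!}{m_1!\,n_2!}}\sum_{r=0}^{n_2}\sum_{j=0}^{m_1}\binom{n_2}{r}\binom{m_1}{j}(-1)^r(\kappa^{-1})^{n_2+j-r}\big(\sqrt{1-\kappa^{-2}}\big)^{m_1+r-j}\,\delta_{n_1,r+j}\,\delta_{m_2,n_2+m_1-r-j};$$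 * (phase conjugator, $\kappa\ge0$) $$T[\mathcal C(\kappa)]^{m_1,m_2}_{n_1,n_2}=\tfrac1{\sqrt{1+\kappa^2}}\sqrt{\tfrac{n_2!\,m_2!}{m_1!\,n_1!}}\sum_{r=0}^{m_1}\sum_{j=0}^{n_1}\binom{m_1}{r}\binom{n_1}{j}(-1)^j\Big(\tfrac1{\sqrt{1+\kappa^2}}\Big)^{n_1+r-j}\Big(\tfrac{\kappa}{\sqrt{1+\kappa^2}}\Big)^{m_1+j-r}\,\delta_{n_2,r+j}\,\delta_{m_2,n_1+m_1-r-j}.$$ **Theorem.** Let $n\ge0$ be an integer and let $T$ be $T[\mathcal B(\kappa)]$ with $0\le\kappa\le1$, or $T[\mathcal A(\kappa)]$ with $\kappa\ge1$, or $T[\mathcal C(\kappa)]$ with $\kappa\ge0$. There is a (necessarily unique) unitary operator $U$ on $\mathcal H\otimes\mathcal H_E$ with $\langle m_1,m_2|U|n_1,n_2\rangle=T^{m_1,m_2}_{n_1,n_2}$ for all indices. Let $F_y={}_E\langle y|U|n\rangle_E$, $y=0,1,2,\dots$, be the Kraus operators of the corresponding $n$-photon-added channel $\rho\mapsto\mathrm{Tr}_E\,U(\rho\otimes|n\rangle\langle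 n|)U^\dagger$; the operator $F_y$ acts when the measurement of the environment in the Fock basis gives the outcome $y$. Then there exist completely positive trace-preserving linear maps $R_y$ ($y=0,1,2,\dots$) on the trace-class operators on $\mathcal H$, depending on the feedback $y$ but not on the input, such that for every Fock state $|x\rangle$ $$\sum_{y=0}^\infty R_y\big(F_y|x\rangle\langle x|F_y^\dagger\big)=|x\rangle\langle x|,$$ the series converging unconditionally in trace norm. In other words, there is an environment-assisted error correction scheme that perfectly restores classical information encoded in the Fock basis. -/

import Mathlib

open scoped ComplexOrder ENNReal

noncomputable section

namespace PhotonAdded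

/-- The Hilbert space `ℓ²(ℕ)` of a single bosonic mode, in its Fock (number) representation. -/
abbrev Mode : Type := lp (fun _ : ℕ => ℂ) 2

/-- The Hilbert space `ℓ²(ℕ × ℕ)` of two bosonic modes: first index system, second index
environment. -/
abbrev TwoMode : Type := lp (fun _ : ℕ × ℕ => ℂ) 2

/-- The Fock state `|k⟩`. -/
def ket (k : ℕ) : Mode := lp.single 2 k (1 : ℂ)

/-- The two-mode Fock state `|k₁, k₂⟩`. -/
def ket₂ (k₁ k₂ : ℕ) : TwoMode := lp.single 2 (k₁, k₂) (1 : ℂ)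

/-! ### Trace-class operators and quantum channels -/

/-- `A = ∑ₖ |uₖ⟩⟨vₖ|` with `∑ₖ ‖uₖ‖ ‖vₖ‖ < ∞`. -/
def IsNuclearRep (A : Mode →L[ℂ] Mode) (u v : ℕ → Mode) : Prop :=
  Summable (fun k => ‖u k‖ * ‖v k‖) ∧
    ∀ ψ : Mode, HasSum (fun k => inner ℂ (v k) ψ • u k) (A ψ)

theorem IsNuclearRep.zero : IsNuclearRep 0 0 0 := by
  refine ⟨by simp, fun ψ => by simp⟩

theorem IsNuclearRep.smul {A : Mode →L[ℂ] Mode} {u v : ℕ → Mode} (h : IsNuclearRep A u v)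
    (c : ℂ) : IsNuclearRep (c • A) (fun k => c • u k) v := by
  refine ⟨?_, fun ψ => ?_⟩
  · simpa [norm_smul, mul_assoc] using h.1.mul_left ‖c‖
  · simpa [smul_comm c] using (h.2 ψ).const_smul c

theorem IsNuclearRep.add {A B : Mode →L[ℂ] Mode} {u v u' v' : ℕ → Mode}
    (h : IsNuclearRep A u v) (h' : IsNuclearRep B u' v') :
    IsNuclearRep (A + B) (fun k => Sum.elim u u' (Equiv.natSumNatEquivNat.symm k))
      (fun k => Sum.elim v v' (Equiv.natSumNatEquivNat.symm k)) := by
  refine ⟨?_, fun ψ => ?_⟩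
  · refine (Equiv.natSumNatEquivNat.symm.summable_iff
      (f := fun s => ‖Sum.elim u u' s‖ * ‖Sum.elim v v' s‖)).2 ?_
    exact (HasSum.sum (f := fun s => ‖Sum.elim u u' s‖ * ‖Sum.elim v v' s‖)
      h.1.hasSum h'.1.hasSum).summable
  · refine (Equiv.natSumNatEquivNat.symm.hasSum_iff
      (f := fun s => inner ℂ (Sum.elim v v' s) ψ • Sum.elim u u' s)).2 ?_
    exact HasSum.sum (f := fun s => inner ℂ (Sum.elim v v' s) ψ • Sum.elim u u' s)
      (h.2 ψ) (h'.2 ψ)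

theorem IsNuclearRep.conj {A : Mode →L[ℂ] Mode} {u v : ℕ → Mode} (h : IsNuclearRep A u v)
    (F : Mode →L[ℂ] Mode) :
    IsNuclearRep (F ∘L A ∘L F.adjoint) (fun k => F (u k)) (fun k => F (v k)) := by
  refine ⟨?_, fun ψ => ?_⟩
  · refine Summable.of_nonneg_of_le (fun k => by positivity) (fun k => ?_)
      (h.1.mul_left (‖F‖ * ‖F‖))
    calc ‖F (u k)‖ * ‖F (v k)‖ ≤ (‖F‖ * ‖u k‖) * (‖F‖ * ‖v k‖) := by
          gcongr <;> exact F.le_opNorm _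
      _ = ‖F‖ * ‖F‖ * (‖u k‖ * ‖v k‖) := by ring
  · simpa [ContinuousLinearMap.adjoint_inner_right] using (h.2 (F.adjoint ψ)).mapL F

theorem IsNuclearRep.rankOne (φ χ : Mode) :
    IsNuclearRep (InnerProductSpace.rankOne ℂ φ χ) (Pi.single 0 φ) (Pi.single 0 χ) := by
  refine ⟨summable_of_ne_finset_zero (s := {0}) fun k hk => ?_, fun ψ => ?_⟩
  · simp [Pi.single_eq_of_ne (Finset.notMem_singleton.1 hk)]
  · have := hasSum_single (f := fun k : ℕ => inner ℂ ((Pi.single 0 χ : ℕ → Mode) k) ψ •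
      (Pi.single 0 φ : ℕ → Mode) k) 0 (fun k hk => by simp [Pi.single_eq_of_ne hk])
    simpa using this

/-- The space `𝒯(ℋ)` of trace-class (nuclear) operators on the one-mode Hilbert space. -/
def TraceClass : Submodule ℂ (Mode →L[ℂ] Mode) where
  carrier := {A | ∃ u v, IsNuclearRep A u v}
  zero_mem' := ⟨_, _, IsNuclearRep.zero⟩
  add_mem' := by
    rintro A B ⟨u, v, h⟩ ⟨u', v', h'⟩
    exact ⟨_, _, h.add h'⟩
  smul_mem' := by
    rintro c A ⟨u, v, h⟩
    exact ⟨_, _, h.smul c⟩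

/-- The trace norm: the infimum of `∑ₖ ‖uₖ‖ ‖vₖ‖` over all representations
`A = ∑ₖ |uₖ⟩⟨vₖ|` (it is `∞` if `A` is not trace class). -/
def traceNorm (A : Mode →L[ℂ] Mode) : ℝ≥0∞ :=
  ⨅ (u : ℕ → Mode) (v : ℕ → Mode) (_ : IsNuclearRep A u v),
    ENNReal.ofReal (∑' k, ‖u k‖ * ‖v k‖)

/-- The trace, evaluated in the Fock basis. -/
def trace (A : TraceClass) : ℂ := ∑' k : ℕ, inner ℂ (ket k) (A.1 (ket k))

/-- The rank-one operator `|φ⟩⟨φ|`. -/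
def proj (φ : Mode) : TraceClass :=
  ⟨InnerProductSpace.rankOne ℂ φ φ, _, _, IsNuclearRep.rankOne φ φ⟩

/-- The map `ρ ↦ F ρ F†` on trace-class operators. -/
def conj (F : Mode →L[ℂ] Mode) : TraceClass →ₗ[ℂ] TraceClass where
  toFun ρ := ⟨F ∘L ρ.1 ∘L F.adjoint, by
    obtain ⟨u, v, h⟩ := ρ.2
    exact ⟨_, _, h.conj F⟩⟩
  map_add' ρ σ := by ext1; ext1 ψ; simp
  map_smul' c ρ := by ext1; ext1 ψ; simp

/-- Positivity of the operator `∑ᵢⱼ ρᵢⱼ ⊗ |i⟩⟨j|` on `ℋ ⊗ ℂᴺ`. -/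
def IsBlockPositive {N : ℕ} (ρ : Fin N → Fin N → TraceClass) : Prop :=
  ∀ ψ : Fin N → Mode, 0 ≤ ∑ i, ∑ j, inner ℂ (ψ i) ((ρ i j).1 (ψ j))

/-- A quantum channel: a completely positive trace-preserving linear map on the trace class. -/
structure IsChannel (R : TraceClass →ₗ[ℂ] TraceClass) : Prop where
  completelyPositive : ∀ (N : ℕ) (ρ : Fin N → Fin N → TraceClass),
    IsBlockPositive ρ → IsBlockPositive fun i j => R (ρ i j)
  tracePreserving : ∀ ρ, trace (R ρ) = trace ρ

/-! ### Dilations and environment-assisted error correction -/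

theorem slice_memℓp (f : TwoMode) (y : ℕ) : Memℓp (fun a : ℕ => f (a, y)) 2 := by
  have h := (memℓp_gen_iff (by norm_num : 0 < (2 : ℝ≥0∞).toReal)).1 (lp.memℓp f)
  refine memℓp_gen ?_
  exact h.comp_injective (i := fun a : ℕ => (a, y)) fun a b hab => (Prod.ext_iff.1 hab).1

/-- The partial inner product `1 ⊗ ⟨y|` with the environment Fock state `|y⟩`. -/
def envBra (y : ℕ) : TwoMode →L[ℂ] Mode :=
  LinearMap.mkContinuous
    { toFun := fun f => ⟨fun a => f (a, y), slice_memℓp f y⟩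
      map_add' := fun f g => by ext a; simp; rfl
      map_smul' := fun c f => by ext a; simp } 1 (fun f => by
        have h2 : 0 < (2 : ℝ≥0∞).toReal := by norm_num
        have hf := (memℓp_gen_iff h2).1 (lp.memℓp f)
        have key : ‖(⟨fun a => f (a, y), slice_memℓp f y⟩ : Mode)‖ ^ (2 : ℝ≥0∞).toReal ≤
            ‖f‖ ^ (2 : ℝ≥0∞).toReal := by
          rw [lp.norm_rpow_eq_tsum h2, lp.norm_rpow_eq_tsum h2]
          have hi : Function.Injective fun a : ℕ => (a, y) :=
            fun a b hab => (Prod.ext_iff.1 hab).1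
          exact tsum_comp_le_tsum_of_inj hf (fun _ => by positivity) hi
        rw [one_mul]
        exact (Real.rpow_le_rpow_iff (norm_nonneg _) (norm_nonneg _) h2).1 key)

/-- The isometry `ψ ↦ ψ ⊗ |n⟩` which appends the environment Fock state `|n⟩`. -/
def envKet (n : ℕ) : Mode →L[ℂ] TwoMode := (envBra n).adjoint

/-- The Kraus operator `F_y = ⟨y|_E U |n⟩_E` of the channel `ρ ↦ Tr_E U (ρ ⊗ |n⟩⟨n|) U†`; it is
the one that acts when a Fock-basis measurement of the environment gives the outcome `y`. -/
def kraus (U : TwoMode ≃ₗᵢ[ℂ] TwoMode) (n y : ℕ) : Mode →L[ℂ] Mode :=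
  envBra y ∘L (U : TwoMode →L[ℂ] TwoMode) ∘L envKet n

/-- `T m₁ m₂ n₁ n₂ = ⟨m₁, m₂| U |n₁, n₂⟩`: the Fock matrix elements of `U` are given by `T`. -/
def HasFockMatrix (U : TwoMode ≃ₗᵢ[ℂ] TwoMode) (T : ℕ → ℕ → ℕ → ℕ → ℝ) : Prop :=
  ∀ m₁ m₂ n₁ n₂, inner ℂ (ket₂ m₁ m₂) (U (ket₂ n₁ n₂)) = (T m₁ m₂ n₁ n₂ : ℂ)

/-- Environment-assisted correction of the classical information encoded in the Fock basis: there
are recovery channels `R_y`, conditioned on the feedback `y` only, such that the corrected channel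
`∑_y R_y ∘ F_y` restores every Fock state, the series converging in trace norm. -/
def FockCorrectable (F : ℕ → Mode →L[ℂ] Mode) : Prop :=
  ∃ R : ℕ → TraceClass →ₗ[ℂ] TraceClass, (∀ y, IsChannel (R y)) ∧
    ∀ x : ℕ, Filter.Tendsto
      (fun s : Finset ℕ =>
        traceNorm ((∑ y ∈ s, R y (conj (F y) (proj (ket x))) - proj (ket x) : TraceClass) :
          Mode →L[ℂ] Mode))
      Filter.atTop (nhds 0)

/-! ### The dilation unitaries

In each sum the summation bounds keep all the natural-number exponents nonnegative. -/

open Nat in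
/-- Fock matrix elements of the two-mode squeezer dilating the amplifier with parameter `κ ≥ 1`. -/
def amplifierT (κ : ℝ) (m₁ m₂ n₁ n₂ : ℕ) : ℝ :=
  κ⁻¹ * √((n₁ ! * m₂ ! : ℝ) / (m₁ ! * n₂ !)) *
    ∑ r ∈ Finset.range (n₂ + 1), ∑ j ∈ Finset.range (m₁ + 1),
      if n₁ = r + j ∧ m₂ + r + j = n₂ + m₁ then
        (n₂.choose r : ℝ) * (m₁.choose j : ℝ) * (-1) ^ r * κ⁻¹ ^ (n₂ + j - r) *
          √(1 - κ⁻¹ ^ 2) ^ (m₁ + r - j)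
      else 0

open Nat in
/-- Fock matrix elements of the beamsplitter dilating the attenuator with parameter
`0 ≤ κ ≤ 1`. -/
def attenuatorT (κ : ℝ) (m₁ m₂ n₁ n₂ : ℕ) : ℝ :=
  √((m₁ ! * m₂ ! : ℝ) / (n₁ ! * n₂ !)) *
    ∑ r ∈ Finset.range (n₁ + 1), ∑ j ∈ Finset.range (n₂ + 1),
      if m₂ = r + j ∧ m₁ + r + j = n₁ + n₂ then
        (n₁.choose r : ℝ) * (n₂.choose j : ℝ) * (-1) ^ (n₂ - j) * κ ^ (n₁ + j - r) *
          √(1 - κ ^ 2) ^ (r + n₂ - j)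
      else 0

open Nat in
/-- Fock matrix elements of the unitary dilating the phase conjugator with parameter `κ ≥ 0`. The
factor `1 / √(1 + κ⁻²)` is written `κ / √(1 + κ²)`, which is the same for `κ > 0` and has the right
value `0` at `κ = 0`. -/
def conjugatorT (κ : ℝ) (m₁ m₂ n₁ n₂ : ℕ) : ℝ :=
  (√(1 + κ ^ 2))⁻¹ * √((n₂ ! * m₂ ! : ℝ) / (m₁ ! * n₁ !)) *
    ∑ r ∈ Finset.range (m₁ + 1), ∑ j ∈ Finset.range (n₁ + 1),
      if n₂ = r + j ∧ m₂ + r + j = n₁ + m₁ then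
        (m₁.choose r : ℝ) * (n₁.choose j : ℝ) * (-1) ^ j *
          (√(1 + κ ^ 2))⁻¹ ^ (n₁ + r - j) * (κ / √(1 + κ ^ 2)) ^ (m₁ + j - r)
      else 0

end PhotonAdded

end

noncomputable section

namespace PhotonAdded

open Finset Nat

/-! ### Coefficients of the exponential of a bilinear form -/

/-! Correctability comes from a selection rule. The beamsplitter conserves the total photon number,
the squeezer conserves the difference of the two photon numbers, and the conjugator is a squeezer
with its two inputs exchanged. With `n` fixed, the outcome `y` and the output Fock number therefore
determine the input `x`. Let `R_y` measure the output in the Fock basis and prepare the decoded Fock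
state. It sends `F_y |x⟩⟨x| F_y†` to `‖F_y |x⟩‖² |x⟩⟨x|`, and these weights sum to 1 because `U`
preserves norms (`fockCorrectable_of_decoder`).

Most of the work is the existence of `U`. Up to factorial normalisation, each `T` is a coefficient
`tableSum` of the exponential of a bilinear form in four variables, and differentiating that
exponential in each variable gives four recursions. For fixed inputs, a column of the matrix is a
power series in two output variables. There multiplication and differentiation are adjoint for the
Bargmann `pairing`, so the recursions become ladder relations, which reduce the Gram matrix of the
columns to the norm of the vacuum column (`gram_eq_of_ladder`). For fixed outputs the rows satisfy
the same relations with `s` replaced by `-s`. Both families are needed in infinite dimension: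
orthonormal columns give an isometry, and orthonormal rows make it surjective
(`exists_unitary_of_orthonormal`). -/

/-- The backward shift of the index of a sequence, with value `0` at `0`. -/
def shift {α : Type*} [Zero α] (f : ℕ → α) : ℕ → α
  | 0 => 0
  | k + 1 => f k

@[simp] theorem shift_zero {α : Type*} [Zero α] (f : ℕ → α) : shift f 0 = 0 := rfl

@[simp] theorem shift_succ {α : Type*} [Zero α] (f : ℕ → α) (k : ℕ) : shift f (k + 1) = f k := rfl

/-- The coefficient of `x ^ p * y ^ q * z ^ u * w ^ v` in
`exp (x * (c₁ * z + c₂ * w) + y * (c₃ * z + c₄ * w))`: a sum over the `2 × 2` tables of natural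
numbers with row sums `p, q` and column sums `u, v`. -/
def tableSum (c₁ c₂ c₃ c₄ : ℝ) (p q u v : ℕ) : ℝ :=
  ∑ i ∈ antidiagonal p, ∑ j ∈ antidiagonal q,
    if i.1 + j.1 = u ∧ i.2 + j.2 = v then
      c₁ ^ i.1 / i.1 ! * (c₂ ^ i.2 / i.2 !) * (c₃ ^ j.1 / j.1 ! * (c₄ ^ j.2 / j.2 !))
    else 0

theorem tableSum_swap_rows (c₁ c₂ c₃ c₄ : ℝ) (p q u v : ℕ) :
    tableSum c₁ c₂ c₃ c₄ p q u v = tableSum c₃ c₄ c₁ c₂ q p u v := by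
  unfold tableSum
  rw [Finset.sum_comm]
  refine sum_congr rfl fun j _ => sum_congr rfl fun i _ => ?_
  simp only [add_comm i.1, add_comm i.2, mul_comm (c₁ ^ i.1 / _ * _)]

theorem tableSum_swap_cols (c₁ c₂ c₃ c₄ : ℝ) (p q u v : ℕ) :
    tableSum c₁ c₂ c₃ c₄ p q u v = tableSum c₂ c₁ c₄ c₃ p q v u := by
  unfold tableSum
  rw [← Finset.Nat.sum_antidiagonal_swap]
  refine sum_congr rfl fun i _ => ?_
  rw [← Finset.Nat.sum_antidiagonal_swap]
  refine sum_congr rfl fun j _ => ?_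
  simp only [Prod.fst_swap, Prod.snd_swap, and_comm, mul_comm (c₁ ^ _ / _),
    mul_comm (c₃ ^ _ / _)]

theorem succ_mul_pow_div_factorial (c : ℝ) (k : ℕ) :
    ((k + 1 : ℕ) : ℝ) * (c ^ (k + 1) / (k + 1)!) = c * (c ^ k / k !) := by
  rw [Nat.factorial_succ]
  have : (k ! : ℝ) ≠ 0 := by positivity
  push_cast
  field_simp
  ring

theorem sum_antidiagonal_fst_mul (c : ℝ) (F : ℕ → ℕ → ℝ) (p : ℕ) :
    ∑ i ∈ antidiagonal p, (i.1 : ℝ) * (c ^ i.1 / i.1 ! * F i.1 i.2) =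
      c * shift (fun p => ∑ i ∈ antidiagonal p, c ^ i.1 / i.1 ! * F (i.1 + 1) i.2) p := by
  cases p with
  | zero => simp
  | succ p =>
    rw [Finset.Nat.sum_antidiagonal_succ, shift_succ, mul_sum]
    simp only [Nat.cast_zero, zero_mul, zero_add]
    refine sum_congr rfl fun i _ => ?_
    rw [← mul_assoc, succ_mul_pow_div_factorial, mul_assoc]

theorem sum_antidiagonal_snd_mul (c : ℝ) (F : ℕ → ℕ → ℝ) (p : ℕ) :
    ∑ i ∈ antidiagonal p, (i.2 : ℝ) * (c ^ i.2 / i.2 ! * F i.1 i.2) =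
      c * shift (fun p => ∑ i ∈ antidiagonal p, c ^ i.2 / i.2 ! * F i.1 (i.2 + 1)) p := by
  rw [← Finset.Nat.sum_antidiagonal_swap]
  refine (sum_antidiagonal_fst_mul c (fun a b => F b a) p).trans ?_
  congr 2
  funext p
  rw [← Finset.Nat.sum_antidiagonal_swap]
  rfl

/-- Coefficients of `∂ₓ E = (c₁ z + c₂ w) E` for the generating exponential `E`. Combinatorially, `p
+ 1` is the sum of the two entries of the first row, and each entry cancels one factor of its own
factorial. -/
theorem tableSum_succ_row₁ (c₁ c₂ c₃ c₄ : ℝ) (p q u v : ℕ) :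
    (p + 1 : ℝ) * tableSum c₁ c₂ c₃ c₄ (p + 1) q u v =
      c₁ * shift (fun u => tableSum c₁ c₂ c₃ c₄ p q u v) u +
        c₂ * shift (fun v => tableSum c₁ c₂ c₃ c₄ p q u v) v := by
  let H : ℕ → ℕ → ℕ → ℕ → ℝ := fun u v a b => ∑ j ∈ antidiagonal q,
    if a + j.1 = u ∧ b + j.2 = v then c₃ ^ j.1 / j.1 ! * (c₄ ^ j.2 / j.2 !) else 0
  have hC : ∀ p u v, tableSum c₁ c₂ c₃ c₄ p q u v =
      ∑ i ∈ antidiagonal p, c₁ ^ i.1 / i.1 ! * (c₂ ^ i.2 / i.2 ! * H u v i.1 i.2) := by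
    intro p u v
    refine sum_congr rfl fun i _ => ?_
    simp only [H, ← mul_assoc, mul_sum, mul_ite, mul_zero]
  have h1 := sum_antidiagonal_fst_mul c₁ (fun a b => c₂ ^ b / b ! * H u v a b) (p + 1)
  have h2 := sum_antidiagonal_snd_mul c₂ (fun a b => c₁ ^ a / a ! * H u v a b) (p + 1)
  have e1 : ∑ i ∈ antidiagonal p, c₁ ^ i.1 / i.1 ! * (c₂ ^ i.2 / i.2 ! * H u v (i.1 + 1) i.2) =
      shift (fun u => tableSum c₁ c₂ c₃ c₄ p q u v) u := by
    cases u with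
    | zero => simp [H, Nat.add_assoc, add_comm 1]
    | succ u =>
      rw [shift_succ, hC]
      refine sum_congr rfl fun i _ => ?_
      simp only [H, Nat.add_right_comm _ 1, Nat.add_right_cancel_iff]
  have e2 : ∑ i ∈ antidiagonal p, c₂ ^ i.2 / i.2 ! * (c₁ ^ i.1 / i.1 ! * H u v i.1 (i.2 + 1)) =
      shift (fun v => tableSum c₁ c₂ c₃ c₄ p q u v) v := by
    cases v with
    | zero => simp [H, Nat.add_assoc, add_comm 1]
    | succ v =>
      rw [shift_succ, hC]
      refine sum_congr rfl fun i _ => ?_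
      simp only [H, Nat.add_right_comm _ 1, Nat.add_right_cancel_iff, mul_left_comm]
  rw [shift_succ] at h1 h2
  rw [← e1, ← e2, ← h1, ← h2, ← sum_add_distrib, hC, mul_sum]
  refine sum_congr rfl fun i hi => ?_
  have : (p + 1 : ℝ) = i.1 + i.2 := by
    have := mem_antidiagonal.1 hi
    exact_mod_cast this.symm
  rw [this]
  ring

theorem tableSum_succ_row₂ (c₁ c₂ c₃ c₄ : ℝ) (p q u v : ℕ) :
    (q + 1 : ℝ) * tableSum c₁ c₂ c₃ c₄ p (q + 1) u v =
      c₃ * shift (fun u => tableSum c₁ c₂ c₃ c₄ p q u v) u +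
        c₄ * shift (fun v => tableSum c₁ c₂ c₃ c₄ p q u v) v := by
  simp only [tableSum_swap_rows c₁ c₂ c₃ c₄]
  exact tableSum_succ_row₁ ..

/-- Coefficients of `∂_z E = (c₁ x + c₃ y) E`: here `u + 1` is split over the two entries of the
first column. -/
theorem tableSum_succ_col₁ (c₁ c₂ c₃ c₄ : ℝ) (p q u v : ℕ) :
    (u + 1 : ℝ) * tableSum c₁ c₂ c₃ c₄ p q (u + 1) v =
      c₁ * shift (fun p => tableSum c₁ c₂ c₃ c₄ p q u v) p +
        c₃ * shift (fun q => tableSum c₁ c₂ c₃ c₄ p q u v) q := by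
  have key : ∀ (c₁ c₂ c₃ c₄ : ℝ) (p q : ℕ), ∑ i ∈ antidiagonal p, ∑ j ∈ antidiagonal q,
      (i.1 : ℝ) * (if i.1 + j.1 = u + 1 ∧ i.2 + j.2 = v then
        c₁ ^ i.1 / i.1 ! * (c₂ ^ i.2 / i.2 !) * (c₃ ^ j.1 / j.1 ! * (c₄ ^ j.2 / j.2 !)) else 0) =
      c₁ * shift (fun p => tableSum c₁ c₂ c₃ c₄ p q u v) p := by
    intro c₁ c₂ c₃ c₄ p q
    have h := sum_antidiagonal_fst_mul c₁ (fun a b => ∑ j ∈ antidiagonal q,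
      if a + j.1 = u + 1 ∧ b + j.2 = v then
        c₂ ^ b / b ! * (c₃ ^ j.1 / j.1 ! * (c₄ ^ j.2 / j.2 !)) else 0) p
    simp only [Nat.add_right_comm _ 1, Nat.add_right_cancel_iff, mul_sum, mul_ite, mul_zero,
      ← mul_assoc] at h
    simp only [tableSum, mul_ite, mul_zero, ← mul_assoc]
    exact h
  rw [← key c₁ c₂ c₃ c₄ p q]
  simp only [tableSum_swap_rows c₁ c₂ c₃ c₄]
  rw [← key c₃ c₄ c₁ c₂ q p, sum_comm (s := antidiagonal p), ← sum_add_distrib]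
  simp only [tableSum, ← sum_add_distrib, mul_sum]
  refine sum_congr rfl fun j _ => sum_congr rfl fun i _ => ?_
  simp only [add_comm i.1, add_comm i.2]
  split_ifs with h
  · have : (u + 1 : ℝ) = j.1 + i.1 := by exact_mod_cast h.1.symm
    rw [this]
    ring
  · simp

theorem tableSum_succ_col₂ (c₁ c₂ c₃ c₄ : ℝ) (p q u v : ℕ) :
    (v + 1 : ℝ) * tableSum c₁ c₂ c₃ c₄ p q u (v + 1) =
      c₂ * shift (fun p => tableSum c₁ c₂ c₃ c₄ p q u v) p +
        c₄ * shift (fun q => tableSum c₁ c₂ c₃ c₄ p q u v) q := by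
  simp only [tableSum_swap_cols c₁ c₂ c₃ c₄]
  exact tableSum_succ_col₁ ..

/-- The row factorials turn the inverse factorials of the entries into binomial coefficients, which
links `tableSum` to the explicit double sums. -/
theorem tableSum_eq_range (c₁ c₂ c₃ c₄ : ℝ) (p q u v : ℕ) :
    (p ! * q ! : ℝ) * tableSum c₁ c₂ c₃ c₄ p q u v =
      ∑ r ∈ range (p + 1), ∑ j ∈ range (q + 1),
        if u = r + j ∧ v + r + j = p + q then
          (p.choose r : ℝ) * (q.choose j : ℝ) *
            (c₁ ^ r * c₂ ^ (p - r) * (c₃ ^ j * c₄ ^ (q - j)))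
        else 0 := by
  simp only [tableSum, Finset.Nat.sum_antidiagonal_eq_sum_range_succ_mk, mul_sum]
  refine sum_congr rfl fun r hr => sum_congr rfl fun j hj => ?_
  have hr' : r ≤ p := Nat.lt_succ_iff.1 (mem_range.1 hr)
  have hj' : j ≤ q := Nat.lt_succ_iff.1 (mem_range.1 hj)
  have hiff : (r + j = u ∧ p - r + (q - j) = v) ↔ (u = r + j ∧ v + r + j = p + q) := by omega
  simp only [hiff]
  split_ifs with h
  · rw [Nat.cast_choose ℝ hr', Nat.cast_choose ℝ hj']
    have h1 : (r ! : ℝ) ≠ 0 := by positivity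
    have h2 : (j ! : ℝ) ≠ 0 := by positivity
    have h3 : ((p - r)! : ℝ) ≠ 0 := by positivity
    have h4 : ((q - j)! : ℝ) ≠ 0 := by positivity
    field_simp
  · simp

/-! ### The Bargmann pairing of power series in two variables -/

/-- Multiplication by the first variable. -/
def mulX₁ (f : ℕ → ℕ → ℝ) : ℕ → ℕ → ℝ := fun a b => shift (fun a => f a b) a

/-- Multiplication by the second variable. -/
def mulX₂ (f : ℕ → ℕ → ℝ) : ℕ → ℕ → ℝ := fun a b => shift (fun b => f a b) b

/-- Derivative in the first variable. -/
def deriv₁ (f : ℕ → ℕ → ℝ) : ℕ → ℕ → ℝ := fun a b => (a + 1 : ℝ) * f (a + 1) b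

/-- Derivative in the second variable. -/
def deriv₂ (f : ℕ → ℕ → ℝ) : ℕ → ℕ → ℝ := fun a b => (b + 1 : ℝ) * f a (b + 1)

/-- The Bargmann pairing of two power series. -/
def pairing (f g : ℕ → ℕ → ℝ) : ℝ := ∑' m : ℕ × ℕ, (m.1 ! * m.2 ! : ℝ) * (f m.1 m.2 * g m.1 m.2)

/-- Power series all of whose polynomially weighted Bargmann norms are finite. -/
def Rapid (f : ℕ → ℕ → ℝ) : Prop :=
  ∀ k : ℕ, Summable fun m : ℕ × ℕ =>
    (m.1 + m.2 + 1 : ℝ) ^ k * ((m.1 ! * m.2 ! : ℝ) * f m.1 m.2 ^ 2)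

theorem Rapid.zero : Rapid 0 := fun k => by simp [summable_zero]

theorem Rapid.smul {f : ℕ → ℕ → ℝ} (hf : Rapid f) (c : ℝ) : Rapid (c • f) := fun k => by
  refine ((hf k).mul_left (c ^ 2)).congr fun m => ?_
  simp only [Pi.smul_apply, smul_eq_mul]
  ring

theorem Rapid.add {f g : ℕ → ℕ → ℝ} (hf : Rapid f) (hg : Rapid g) : Rapid (f + g) := fun k => by
  refine Summable.of_nonneg_of_le (fun m => by positivity) (fun m => ?_)
    (((hf k).add (hg k)).mul_left 2)
  calc (m.1 + m.2 + 1 : ℝ) ^ k * ((m.1 ! * m.2 ! : ℝ) * (f + g) m.1 m.2 ^ 2)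
      ≤ (m.1 + m.2 + 1 : ℝ) ^ k * ((m.1 ! * m.2 ! : ℝ) *
          (2 * (f m.1 m.2 ^ 2 + g m.1 m.2 ^ 2))) := by
        gcongr
        exact add_sq_le
    _ = _ := by ring

theorem succ_fst_injective : Function.Injective fun m : ℕ × ℕ => (m.1 + 1, m.2) := by
  rintro ⟨a, b⟩ ⟨c, d⟩ h
  simpa using h

theorem mem_range_succ_fst {m : ℕ × ℕ} (h : m.1 ≠ 0) :
    m ∈ Set.range fun m : ℕ × ℕ => (m.1 + 1, m.2) :=
  ⟨(m.1 - 1, m.2), Prod.ext (Nat.succ_pred_eq_of_ne_zero h) rfl⟩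

theorem Rapid.swap {f : ℕ → ℕ → ℝ} (hf : Rapid f) : Rapid fun a b => f b a := fun k => by
  refine ((Equiv.prodComm ℕ ℕ).summable_iff.2 (hf k)).congr fun m => ?_
  simp only [Function.comp, Equiv.prodComm_apply, Prod.fst_swap, Prod.snd_swap,
    add_comm (m.2 : ℝ), mul_comm (m.2 ! : ℝ)]

/-- Multiplying by a variable raises a factorial, which costs one power of the weight. This is why
`Rapid` asks for every polynomial weight. -/
theorem Rapid.mulX₁ {f : ℕ → ℕ → ℝ} (hf : Rapid f) : Rapid (mulX₁ f) := fun k => by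
  refine (succ_fst_injective.summable_iff fun m hm => ?_).1 ?_
  · have : m.1 = 0 := by_contra fun h => hm (mem_range_succ_fst h)
    simp [PhotonAdded.mulX₁, this]
  · refine Summable.of_nonneg_of_le (fun m => ?_) (fun m => ?_) ((hf (k + 1)).mul_left (2 ^ k))
    · simp only [Function.comp]
      positivity
    · simp only [Function.comp, PhotonAdded.mulX₁, shift_succ, Nat.factorial_succ]
      push_cast
      calc ((m.1 : ℝ) + 1 + m.2 + 1) ^ k * ((m.1 + 1) * m.1 ! * m.2 ! * f m.1 m.2 ^ 2)
          ≤ (2 * ((m.1 : ℝ) + m.2 + 1)) ^ k *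
              ((m.1 + m.2 + 1) * m.1 ! * m.2 ! * f m.1 m.2 ^ 2) := by
            have h1 : (0 : ℝ) ≤ m.1 := by positivity
            have h2 : (0 : ℝ) ≤ m.2 := by positivity
            gcongr <;> linarith
        _ = _ := by
            rw [mul_pow]
            ring

theorem Rapid.mulX₂ {f : ℕ → ℕ → ℝ} (hf : Rapid f) : Rapid (mulX₂ f) :=
  hf.swap.mulX₁.swap

theorem Rapid.summable_pairing {f g : ℕ → ℕ → ℝ} (hf : Rapid f) (hg : Rapid g) :
    Summable fun m : ℕ × ℕ => (m.1 ! * m.2 ! : ℝ) * (f m.1 m.2 * g m.1 m.2) := by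
  refine Summable.of_norm_bounded ((hf 0).add (hg 0)) fun m => ?_
  simp only [pow_zero, one_mul, ← mul_add]
  rw [norm_mul, Real.norm_of_nonneg (by positivity), Real.norm_eq_abs]
  gcongr
  rw [abs_le]
  constructor <;> nlinarith [sq_nonneg (f m.1 m.2 + g m.1 m.2),
    sq_nonneg (f m.1 m.2 - g m.1 m.2), sq_nonneg (f m.1 m.2), sq_nonneg (g m.1 m.2)]

theorem pairing_comm (f g : ℕ → ℕ → ℝ) : pairing f g = pairing g f := by
  simp only [pairing, mul_comm (f _ _)]

theorem pairing_swap (f g : ℕ → ℕ → ℝ) :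
    pairing (fun a b => f b a) (fun a b => g b a) = pairing f g := by
  unfold pairing
  rw [← (Equiv.prodComm ℕ ℕ).tsum_eq]
  refine tsum_congr fun m => ?_
  simp only [Equiv.prodComm_apply, Prod.fst_swap, Prod.snd_swap]
  ring

theorem pairing_smul_left (c : ℝ) (f g : ℕ → ℕ → ℝ) :
    pairing (c • f) g = c * pairing f g := by
  simp only [pairing, Pi.smul_apply, smul_eq_mul, ← tsum_mul_left]
  exact tsum_congr fun m => by ring

theorem pairing_add_left {f f' g : ℕ → ℕ → ℝ} (hf : Rapid f) (hf' : Rapid f') (hg : Rapid g) :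
    pairing (f + f') g = pairing f g + pairing f' g := by
  rw [pairing, pairing, pairing,
    ← (hf.summable_pairing hg).tsum_add (hf'.summable_pairing hg)]
  exact tsum_congr fun m => by simp only [Pi.add_apply]; ring

@[simp] theorem pairing_zero_left (g : ℕ → ℕ → ℝ) : pairing 0 g = 0 := by simp [pairing]

@[simp] theorem pairing_zero_right (g : ℕ → ℕ → ℝ) : pairing g 0 = 0 := by simp [pairing]

theorem pairing_combo_left {f f' g : ℕ → ℕ → ℝ} (hf : Rapid f) (hf' : Rapid f') (hg : Rapid g)
    (c c' : ℝ) : pairing (c • f + c' • f') g = c * pairing f g + c' * pairing f' g := by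
  rw [pairing_add_left (hf.smul c) (hf'.smul c') hg, pairing_smul_left, pairing_smul_left]

theorem pairing_combo_right {f f' g : ℕ → ℕ → ℝ} (hf : Rapid f) (hf' : Rapid f') (hg : Rapid g)
    (c c' : ℝ) : pairing g (c • f + c' • f') = c * pairing g f + c' * pairing g f' := by
  simp only [pairing_comm g, pairing_combo_left hf hf' hg]

/-- Adjointness is `(a + 1)! = (a + 1) * a !`. Terms with first index 0 vanish, so the sum can be
reindexed along the successor without any summability assumption. -/
theorem pairing_mulX₁ (f g : ℕ → ℕ → ℝ) : pairing (mulX₁ f) g = pairing f (deriv₁ g) := by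
  unfold pairing
  rw [← succ_fst_injective.tsum_eq]
  · refine tsum_congr fun m => ?_
    simp only [mulX₁, deriv₁, shift_succ, Nat.factorial_succ]
    push_cast
    ring
  · intro m hm
    refine mem_range_succ_fst fun h => hm ?_
    simp [mulX₁, h]

theorem pairing_mulX₂ (f g : ℕ → ℕ → ℝ) : pairing (mulX₂ f) g = pairing f (deriv₂ g) := by
  rw [← pairing_swap, ← pairing_swap f]
  exact pairing_mulX₁ (fun a b => f b a) (fun a b => g b a)

/-! ### Ladder relations and the Gram matrices they force -/

/-- A Gram matrix that satisfies the ladder relations of the Fock basis is diagonal. -/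
theorem gram_eq_of_ladder (c : ℕ → ℕ → ℕ → ℕ → ℝ)
    (h₁ : ∀ n₁ n₂ k₁ k₂ : ℕ, (n₁ + 1 : ℝ) * pairing (c (n₁ + 1) n₂) (c k₁ k₂) =
      pairing (c n₁ n₂) (shift (fun k => c k k₂) k₁))
    (h₂ : ∀ n₁ n₂ k₁ k₂ : ℕ, (n₂ + 1 : ℝ) * pairing (c n₁ (n₂ + 1)) (c k₁ k₂) =
      pairing (c n₁ n₂) (shift (fun k => c k₁ k) k₂)) (n₁ n₂ k₁ k₂ : ℕ) :
    (n₁ ! * n₂ ! : ℝ) * pairing (c n₁ n₂) (c k₁ k₂) =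
      if n₁ = k₁ ∧ n₂ = k₂ then pairing (c 0 0) (c 0 0) else 0 := by
  -- Lowering index 0 gives 0 (the default value of `shift`), so a raised vector is orthogonal to
  -- every vector with that index 0.
  have z₁ : ∀ n₁ n₂ k₂, pairing (c (n₁ + 1) n₂) (c 0 k₂) = 0 := fun n₁ n₂ k₂ => by
    have := h₁ n₁ n₂ 0 k₂
    have h0 : (n₁ + 1 : ℝ) ≠ 0 := by positivity
    simpa [h0] using this
  have z₂ : ∀ n₁ n₂ k₁, pairing (c n₁ (n₂ + 1)) (c k₁ 0) = 0 := fun n₁ n₂ k₁ => by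
    have := h₂ n₁ n₂ k₁ 0
    have h0 : (n₂ + 1 : ℝ) ≠ 0 := by positivity
    simpa [h0] using this
  induction n₁ generalizing k₁ with
  | zero =>
    cases k₁ with
    | succ k₁ => rw [pairing_comm, z₁]; simp
    | zero =>
      induction n₂ generalizing k₂ with
      | zero =>
        cases k₂ with
        | succ k₂ => rw [pairing_comm, z₂]; simp
        | zero => simp
      | succ n₂ ih =>
        cases k₂ with
        | zero => rw [z₂]; simp
        | succ k₂ =>
          have h := h₂ 0 n₂ 0 (k₂ + 1)
          have ih := ih k₂
          rw [shift_succ] at h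
          rw [← h] at ih
          simp only [Nat.factorial_succ, Nat.add_right_cancel_iff] at ih ⊢
          rw [← ih]
          push_cast
          ring
  | succ n₁ ih =>
    cases k₁ with
    | zero => rw [z₁]; simp
    | succ k₁ =>
      have h := h₁ n₁ n₂ (k₁ + 1) k₂
      have ih := ih k₁
      rw [shift_succ] at h
      rw [← h] at ih
      simp only [Nat.factorial_succ, Nat.add_right_cancel_iff] at ih ⊢
      rw [← ih]
      push_cast
      ring

theorem Rapid.shift {c : ℕ → ℕ → ℕ → ℝ} (h : ∀ n, Rapid (c n)) (n : ℕ) :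
    Rapid (shift c n) := by
  cases n with
  | zero => exact Rapid.zero
  | succ n => exact h n

/-- Rapid decay is propagated by ladder relations in the two indices. -/
theorem rapid_of_ladder {c : ℕ → ℕ → ℕ → ℕ → ℝ} (h₀ : Rapid (c 0 0))
    (h₁ : ∀ n₁, (∀ n₂, Rapid (c n₁ n₂)) → ∀ n₂, Rapid ((n₁ + 1 : ℝ) • c (n₁ + 1) n₂))
    (h₂ : ∀ n₂, Rapid (c 0 n₂) → Rapid ((n₂ + 1 : ℝ) • c 0 (n₂ + 1))) (n₁ n₂ : ℕ) :
    Rapid (c n₁ n₂) := by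
  have cancel : ∀ (n : ℕ) (f : ℕ → ℕ → ℝ), Rapid ((n + 1 : ℝ) • f) → Rapid f := fun n f h => by
    have h0 : (n + 1 : ℝ) ≠ 0 := by positivity
    simpa [smul_smul, inv_mul_cancel₀ h0] using h.smul (n + 1 : ℝ)⁻¹
  induction n₁ generalizing n₂ with
  | zero =>
    induction n₂ with
    | zero => exact h₀
    | succ n₂ ih => exact cancel n₂ _ (h₂ n₂ ih)
  | succ n₁ ih => exact cancel n₁ _ (h₁ n₁ ih n₂)

/-- The relations between the columns of the matrix of a beamsplitter. -/
structure BeamsplitterLadder (k s : ℝ) (c : ℕ → ℕ → ℕ → ℕ → ℝ) : Prop where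
  zero : ∀ a b, c 0 0 a b = if a = 0 ∧ b = 0 then 1 else 0
  succ₁ : ∀ n₁ n₂ : ℕ, (n₁ + 1 : ℝ) • c (n₁ + 1) n₂ = k • mulX₁ (c n₁ n₂) + s • mulX₂ (c n₁ n₂)
  succ₂ : ∀ n₁ n₂ : ℕ, (n₂ + 1 : ℝ) • c n₁ (n₂ + 1) = (-s) • mulX₁ (c n₁ n₂) + k • mulX₂ (c n₁ n₂)
  deriv₁ : ∀ n₁ n₂ : ℕ, deriv₁ (c n₁ n₂) =
    k • shift (fun n => c n n₂) n₁ + (-s) • shift (fun n => c n₁ n) n₂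
  deriv₂ : ∀ n₁ n₂ : ℕ, deriv₂ (c n₁ n₂) =
    s • shift (fun n => c n n₂) n₁ + k • shift (fun n => c n₁ n) n₂

theorem BeamsplitterLadder.rapid {k s : ℝ} {c : ℕ → ℕ → ℕ → ℕ → ℝ}
    (h : BeamsplitterLadder k s c) (n₁ n₂ : ℕ) : Rapid (c n₁ n₂) := by
  refine rapid_of_ladder (fun p => ?_) (fun n₁ ih n₂ => ?_) (fun n₂ ih => ?_) n₁ n₂
  · refine summable_of_ne_finset_zero (s := {(0, 0)}) fun m hm => ?_
    have : ¬(m.1 = 0 ∧ m.2 = 0) := fun h => hm (by simp [Prod.ext_iff, h])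
    simp [h.zero, this]
  · rw [h.succ₁]
    exact ((ih n₂).mulX₁.smul k).add ((ih n₂).mulX₂.smul s)
  · rw [h.succ₂]
    exact (ih.mulX₁.smul _).add (ih.mulX₂.smul k)

/-- Raising `n₁` is `k X₁ + s X₂`, whose adjoint `k ∂₁ + s ∂₂` lowers `k₁` with factor `k² + s² =
1`, the cross terms cancelling. The second mode is alike. -/
theorem BeamsplitterLadder.gram {k s : ℝ} {c : ℕ → ℕ → ℕ → ℕ → ℝ}
    (h : BeamsplitterLadder k s c) (hks : k ^ 2 + s ^ 2 = 1) (n₁ n₂ k₁ k₂ : ℕ) :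
    (n₁ ! * n₂ ! : ℝ) * pairing (c n₁ n₂) (c k₁ k₂) = if n₁ = k₁ ∧ n₂ = k₂ then 1 else 0 := by
  have hr := h.rapid
  have h00 : pairing (c 0 0) (c 0 0) = 1 := by
    rw [pairing, tsum_eq_single (0, 0) fun m hm => ?_]
    · simp [h.zero]
    · have : ¬(m.1 = 0 ∧ m.2 = 0) := fun h => hm (by simp [Prod.ext_iff, h])
      simp [h.zero, this]
  rw [gram_eq_of_ladder c (fun n₁ n₂ k₁ k₂ => ?_) (fun n₁ n₂ k₁ k₂ => ?_), h00]
  · rw [← pairing_smul_left, h.succ₁, pairing_combo_left (hr _ _).mulX₁ (hr _ _).mulX₂ (hr _ _),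
      pairing_mulX₁, pairing_mulX₂, h.deriv₁, h.deriv₂,
      pairing_combo_right (Rapid.shift (fun _ => hr _ _) _) (Rapid.shift (fun _ => hr _ _) _)
        (hr _ _),
      pairing_combo_right (Rapid.shift (fun _ => hr _ _) _) (Rapid.shift (fun _ => hr _ _) _)
        (hr _ _)]
    linear_combination pairing (c n₁ n₂) (shift (fun n => c n k₂) k₁) * hks
  · rw [← pairing_smul_left, h.succ₂, pairing_combo_left (hr _ _).mulX₁ (hr _ _).mulX₂ (hr _ _),
      pairing_mulX₁, pairing_mulX₂, h.deriv₁, h.deriv₂,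
      pairing_combo_right (Rapid.shift (fun _ => hr _ _) _) (Rapid.shift (fun _ => hr _ _) _)
        (hr _ _),
      pairing_combo_right (Rapid.shift (fun _ => hr _ _) _) (Rapid.shift (fun _ => hr _ _) _)
        (hr _ _)]
    linear_combination pairing (c n₁ n₂) (shift (fun n => c k₁ n) k₂) * hks

/-- The relations between the columns of the matrix of a two-mode squeezer. -/
structure SqueezerLadder (l s : ℝ) (c : ℕ → ℕ → ℕ → ℕ → ℝ) : Prop where
  zero : ∀ a b, c 0 0 a b = if a = b then s ^ a / a ! else 0
  succ₁ : ∀ n₁ n₂ : ℕ, (n₁ + 1 : ℝ) • c (n₁ + 1) n₂ =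
    l • mulX₁ (c n₁ n₂) + (-s) • shift (fun n => c n₁ n) n₂
  succ₂ : ∀ n₁ n₂ : ℕ, (n₂ + 1 : ℝ) • c n₁ (n₂ + 1) =
    l • mulX₂ (c n₁ n₂) + (-s) • shift (fun n => c n n₂) n₁
  deriv₁ : ∀ n₁ n₂ : ℕ, deriv₁ (c n₁ n₂) = l • shift (fun n => c n n₂) n₁ + s • mulX₂ (c n₁ n₂)
  deriv₂ : ∀ n₁ n₂ : ℕ, deriv₂ (c n₁ n₂) = l • shift (fun n => c n₁ n) n₂ + s • mulX₁ (c n₁ n₂)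

theorem diagonal_injective : Function.Injective fun a : ℕ => (a, a) :=
  fun _ _ h => (Prod.ext_iff.1 h).1

theorem mem_range_diagonal {m : ℕ × ℕ} (h : m.1 = m.2) : m ∈ Set.range fun a : ℕ => (a, a) :=
  ⟨m.1, Prod.ext rfl h⟩

/-- In the vacuum column the factorials cancel, leaving the geometric terms `(s ^ 2) ^ a` times a
polynomial. -/
theorem SqueezerLadder.rapid {l s : ℝ} {c : ℕ → ℕ → ℕ → ℕ → ℝ}
    (h : SqueezerLadder l s c) (hs : s ^ 2 < 1) (n₁ n₂ : ℕ) : Rapid (c n₁ n₂) := by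
  refine rapid_of_ladder (fun p => ?_) (fun n₁ ih n₂ => ?_) (fun n₂ ih => ?_) n₁ n₂
  · refine (diagonal_injective.summable_iff fun m hm => ?_).1 ?_
    · have : m.1 ≠ m.2 := fun h => hm (mem_range_diagonal h)
      simp [h.zero, this]
    · have hb : Summable fun a : ℕ => ((a + 1 : ℕ) : ℝ) ^ p * (s ^ 2) ^ (a + 1) :=
        (summable_nat_add_iff 1 (f := fun a : ℕ => (a : ℝ) ^ p * (s ^ 2) ^ a)).2
          (summable_pow_mul_geometric_of_norm_lt_one p
            (by rwa [Real.norm_of_nonneg (sq_nonneg s)]))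
      -- The comparison series has exponent `a + 1`, so its constant divides by `s ^ 2`.
      by_cases hs0 : s = 0
      · refine summable_of_ne_finset_zero (s := {0}) fun a ha => ?_
        have : a ≠ 0 := fun h => ha (by simp [h])
        simp [h.zero, hs0, this]
      refine Summable.of_nonneg_of_le (fun m => ?_) (fun a => ?_) (hb.mul_left (2 ^ p / s ^ 2))
      · simp only [Function.comp]
        positivity
      · simp only [Function.comp, h.zero, if_true]
        have hf : (a ! : ℝ) ≠ 0 := by positivity
        calc ((a : ℝ) + a + 1) ^ p * ((a ! * a ! : ℝ) * (s ^ a / a !) ^ 2)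
            = ((a : ℝ) + a + 1) ^ p * (s ^ 2) ^ a := by
              field_simp
              ring
          _ ≤ (2 * (a + 1)) ^ p * (s ^ 2) ^ a := by
              gcongr
              linarith
          _ = _ := by
              push_cast
              rw [mul_pow]
              field_simp
              ring
  · rw [h.succ₁]
    exact ((ih n₂).mulX₁.smul l).add ((Rapid.shift ih n₂).smul _)
  · rw [h.succ₂]
    exact (ih.mulX₂.smul l).add (Rapid.zero.smul _)

/-- Raising and lowering mix multiplication with `shift`, so adjointness alone does not close the
recursion: the pairings with `mulX₁` and `mulX₂` are each expressed through the other and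
eliminated. The vacuum norm is the geometric series `1 / (1 - s ^ 2)`, which the prefactor `l ^ 2`
cancels. -/
theorem SqueezerLadder.gram {l s : ℝ} {c : ℕ → ℕ → ℕ → ℕ → ℝ}
    (h : SqueezerLadder l s c) (hls : l ^ 2 + s ^ 2 = 1) (hl : l ≠ 0) (n₁ n₂ k₁ k₂ : ℕ) :
    (n₁ ! * n₂ ! : ℝ) * (l ^ 2 * pairing (c n₁ n₂) (c k₁ k₂)) =
      if n₁ = k₁ ∧ n₂ = k₂ then 1 else 0 := by
  have hl2 : 0 < l ^ 2 := by positivity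
  have hs : s ^ 2 < 1 := by linarith
  have hr := h.rapid hs
  have h00 : pairing (c 0 0) (c 0 0) = (l ^ 2)⁻¹ := by
    rw [pairing, ← diagonal_injective.tsum_eq]
    · rw [show l ^ 2 = 1 - s ^ 2 by linarith, ← tsum_geometric_of_lt_one (sq_nonneg s) hs]
      refine tsum_congr fun a => ?_
      have hf : (a ! : ℝ) ≠ 0 := by positivity
      simp only [h.zero, if_true]
      field_simp
      ring
    · intro m hm
      refine mem_range_diagonal (by_contra fun hne => hm ?_)
      simp [h.zero, hne]
  have key : ∀ n₁ n₂ k₁ k₂ : ℕ,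
      (n₁ + 1 : ℝ) * pairing (c (n₁ + 1) n₂) (c k₁ k₂) =
        pairing (c n₁ n₂) (shift (fun k => c k k₂) k₁) ∧
      (k₂ + 1 : ℝ) * pairing (c n₁ n₂) (c k₁ (k₂ + 1)) =
        pairing (shift (fun n => c n₁ n) n₂) (c k₁ k₂) := by
    intro n₁ n₂ k₁ k₂
    have r1 : Rapid (shift (fun k => c k k₂) k₁) := Rapid.shift (fun _ => hr _ _) _
    have r2 : Rapid (shift (fun n => c n₁ n) n₂) := Rapid.shift (fun _ => hr _ _) _
    have hX : (n₁ + 1 : ℝ) * pairing (c (n₁ + 1) n₂) (c k₁ k₂) =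
        l * pairing (mulX₁ (c n₁ n₂)) (c k₁ k₂) +
          (-s) * pairing (shift (fun n => c n₁ n) n₂) (c k₁ k₂) := by
      rw [← pairing_smul_left, h.succ₁, pairing_combo_left (hr _ _).mulX₁ r2 (hr _ _)]
    have hY : (k₂ + 1 : ℝ) * pairing (c n₁ n₂) (c k₁ (k₂ + 1)) =
        l * pairing (mulX₂ (c k₁ k₂)) (c n₁ n₂) +
          (-s) * pairing (c n₁ n₂) (shift (fun k => c k k₂) k₁) := by
      rw [pairing_comm, ← pairing_smul_left, h.succ₂,
        pairing_combo_left (hr _ _).mulX₂ r1 (hr _ _), pairing_comm (shift _ _)]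
    have hZ : pairing (mulX₁ (c n₁ n₂)) (c k₁ k₂) =
        l * pairing (c n₁ n₂) (shift (fun k => c k k₂) k₁) +
          s * pairing (mulX₂ (c k₁ k₂)) (c n₁ n₂) := by
      rw [pairing_mulX₁, h.deriv₁, pairing_combo_right r1 (hr _ _).mulX₂ (hr _ _),
        pairing_comm (mulX₂ _)]
    have hW : pairing (mulX₂ (c k₁ k₂)) (c n₁ n₂) =
        l * pairing (shift (fun n => c n₁ n) n₂) (c k₁ k₂) +
          s * pairing (mulX₁ (c n₁ n₂)) (c k₁ k₂) := by
      rw [pairing_mulX₂, h.deriv₂, pairing_combo_right r2 (hr _ _).mulX₁ (hr _ _),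
        pairing_comm (mulX₁ _), pairing_comm (shift _ _)]
    generalize pairing (mulX₁ (c n₁ n₂)) (c k₁ k₂) = Z at *
    generalize pairing (mulX₂ (c k₁ k₂)) (c n₁ n₂) = W at *
    generalize pairing (c n₁ n₂) (shift (fun k => c k k₂) k₁) = P at *
    generalize pairing (shift (fun n => c n₁ n) n₂) (c k₁ k₂) = Q at *
    -- Substituting `hW` into `hZ` gives `(1 - s ^ 2) * Z = l * P + l * s * Q`. Since `1 - s ^ 2 = l
    -- ^ 2`, one factor `l` cancels.
    have eZ : l * Z = P + s * Q := by
      refine mul_left_cancel₀ hl ?_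
      linear_combination hZ + s * hW + Z * hls
    have eW : l * W = Q + s * P := by
      refine mul_left_cancel₀ hl ?_
      linear_combination hW + s * hZ + W * hls
    constructor <;> linarith
  have h2 : ∀ n₁ n₂ k₁ k₂ : ℕ, (n₂ + 1 : ℝ) * pairing (c n₁ (n₂ + 1)) (c k₁ k₂) =
      pairing (c n₁ n₂) (shift (fun k => c k₁ k) k₂) := fun n₁ n₂ k₁ k₂ => by
    rw [pairing_comm, (key k₁ k₂ n₁ n₂).2, pairing_comm]
  have := gram_eq_of_ladder c (fun n₁ n₂ k₁ k₂ => (key n₁ n₂ k₁ k₂).1) h2 n₁ n₂ k₁ k₂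
  rw [mul_left_comm, this, h00]
  split_ifs <;> simp [hl]

end PhotonAdded
end

noncomputable section

namespace PhotonAdded

open Finset Nat

/-! ### Unitaries with a prescribed real matrix -/

theorem exists_orthonormal_coe {ι : Type*} [DecidableEq ι] (v : ι → ι → ℝ)
    (hs : ∀ n, Summable fun m => v n m ^ 2)
    (ho : ∀ n k, ∑' m, v n m * v k m = if n = k then 1 else 0) :
    ∃ w : ι → lp (fun _ : ι => ℂ) 2, Orthonormal ℂ w ∧ ∀ n m, w n m = (v n m : ℂ) := by
  have hmem : ∀ n, Memℓp (fun m => (v n m : ℂ)) 2 := fun n =>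
    memℓp_gen ((hs n).congr fun m => by simp)
  refine ⟨fun n => ⟨fun m => (v n m : ℂ), hmem n⟩, ?_, fun n m => rfl⟩
  rw [orthonormal_iff_ite]
  intro n k
  rw [lp.inner_eq_tsum]
  calc ∑' m, inner ℂ (v n m : ℂ) (v k m : ℂ) = ∑' m, ((v n m * v k m : ℝ) : ℂ) :=
        tsum_congr fun m => by simp [mul_comm]
    _ = _ := by
        rw [← Complex.ofReal_tsum, ho]
        split_ifs <;> simp

/-- A real matrix whose rows and whose columns are orthonormal is the matrix of a unitary. -/
theorem exists_unitary_of_orthonormal {ι : Type*} [DecidableEq ι] (M : ι → ι → ℝ)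
    (hcs : ∀ n, Summable fun m => M m n ^ 2)
    (hc : ∀ n k, ∑' m, M m n * M m k = if n = k then 1 else 0)
    (hrs : ∀ m, Summable fun n => M m n ^ 2)
    (hr : ∀ m k, ∑' n, M m n * M k n = if m = k then 1 else 0) :
    ∃ U : lp (fun _ : ι => ℂ) 2 ≃ₗᵢ[ℂ] lp (fun _ : ι => ℂ) 2,
      ∀ m n, U (lp.single 2 n (1 : ℂ)) m = (M m n : ℂ) := by
  obtain ⟨w, hw, hwM⟩ := exists_orthonormal_coe (fun n m => M m n) hcs hc
  obtain ⟨z, hz, hzM⟩ := exists_orthonormal_coe M hrs hr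
  -- The rows define an isometry `ψ ↦ ∑ₘ ψ m • z m`. As `M` is real, its `n`-th coordinate is the
  -- inner product of `ψ` with column `n`, so a vector orthogonal to all columns is sent to 0 and
  -- must vanish.
  have hbot : (Submodule.span ℂ (Set.range w))ᗮ = ⊥ := by
    rw [Submodule.eq_bot_iff]
    intro ψ hψ
    have h0 : hz.orthogonalFamily.linearIsometry ψ = 0 := by
      ext n
      have h1 := (hz.orthogonalFamily.hasSum_linearIsometry ψ).mapL
        (innerSL ℂ (lp.single (E := fun _ : ι => ℂ) 2 n (1 : ℂ)))
      simp only [innerSL_apply_apply, lp.inner_single_left (𝕜 := ℂ) (G := fun _ : ι => ℂ), LinearIsometry.toSpanSingleton_apply,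
        lp.coeFn_smul, Pi.smul_apply, hzM] at h1
      have h2 := lp.hasSum_inner (𝕜 := ℂ) (w n) ψ
      rw [(Submodule.mem_orthogonal _ _).1 hψ _ (Submodule.subset_span ⟨n, rfl⟩)] at h2
      simp only [hwM] at h2
      have h3 := h1.unique (h2.congr_fun fun m => by simp)
      simpa using h3
    exact (map_eq_zero_iff _ hz.orthogonalFamily.linearIsometry.injective).1 h0
  refine ⟨(HilbertBasis.mkOfOrthogonalEqBot hw hbot).repr.symm, fun m n => ?_⟩
  rw [HilbertBasis.repr_symm_single, HilbertBasis.coe_mkOfOrthogonalEqBot, hwM]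

theorem tsum_kernel (l : ℝ) (c : ℕ → ℕ → ℕ → ℕ → ℝ)
    (hg : ∀ n₁ n₂ k₁ k₂ : ℕ, (n₁ ! * n₂ ! : ℝ) * (l ^ 2 * pairing (c n₁ n₂) (c k₁ k₂)) =
      if n₁ = k₁ ∧ n₂ = k₂ then 1 else 0) (n k : ℕ × ℕ) :
    ∑' m : ℕ × ℕ, (l * √(m.1 ! * m.2 ! * (n.1 ! * n.2 !)) * c n.1 n.2 m.1 m.2) *
      (l * √(m.1 ! * m.2 ! * (k.1 ! * k.2 !)) * c k.1 k.2 m.1 m.2) = if n = k then 1 else 0 := by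
  have : ∀ m : ℕ × ℕ, (l * √(m.1 ! * m.2 ! * (n.1 ! * n.2 !)) * c n.1 n.2 m.1 m.2) *
      (l * √(m.1 ! * m.2 ! * (k.1 ! * k.2 !)) * c k.1 k.2 m.1 m.2) =
      (l ^ 2 * (√(n.1 ! * n.2 !) * √(k.1 ! * k.2 !))) *
        ((m.1 ! * m.2 ! : ℝ) * (c n.1 n.2 m.1 m.2 * c k.1 k.2 m.1 m.2)) := fun m => by
    have hm : 0 ≤ (m.1 ! * m.2 ! : ℝ) := by positivity
    rw [Real.sqrt_mul hm, Real.sqrt_mul hm]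
    linear_combination l ^ 2 * √(n.1 ! * n.2 !) * √(k.1 ! * k.2 !) * c n.1 n.2 m.1 m.2 *
      c k.1 k.2 m.1 m.2 * Real.mul_self_sqrt hm
  rw [tsum_congr this, tsum_mul_left]
  have h := hg n.1 n.2 k.1 k.2
  change _ * pairing (c n.1 n.2) (c k.1 k.2) = _
  by_cases hnk : n = k
  · subst hnk
    rw [Real.mul_self_sqrt (by positivity)]
    simp only [and_self, if_true] at h ⊢
    linarith
  · have hnk' : ¬(n.1 = k.1 ∧ n.2 = k.2) := fun h => hnk (Prod.ext h.1 h.2)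
    rw [if_neg hnk'] at h
    rw [if_neg hnk]
    have hf : (n.1 ! * n.2 ! : ℝ) ≠ 0 := by positivity
    have h0 := (mul_eq_zero.1 h).resolve_left hf
    linear_combination √(n.1 ! * n.2 !) * √(k.1 ! * k.2 !) * h0

theorem summable_kernel (l : ℝ) {c : ℕ → ℕ → ℕ → ℕ → ℝ} (hr : ∀ n₁ n₂, Rapid (c n₁ n₂))
    (n : ℕ × ℕ) :
    Summable fun m : ℕ × ℕ => (l * √(m.1 ! * m.2 ! * (n.1 ! * n.2 !)) * c n.1 n.2 m.1 m.2) ^ 2 := by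
  refine ((hr n.1 n.2 0).mul_left (l ^ 2 * (n.1 ! * n.2 !))).congr fun m => ?_
  rw [mul_pow, mul_pow, Real.sq_sqrt (by positivity)]
  ring

/-- A matrix in the Fock basis whose columns, and whose rows, are given by kernels with diagonal
Gram matrices is the matrix of a unitary. -/
theorem exists_unitary_of_gram (l : ℝ) (T : ℕ → ℕ → ℕ → ℕ → ℝ) (c c' : ℕ → ℕ → ℕ → ℕ → ℝ)
    (hT : ∀ m₁ m₂ n₁ n₂ : ℕ, T m₁ m₂ n₁ n₂ =
      l * √(m₁ ! * m₂ ! * (n₁ ! * n₂ !)) * c n₁ n₂ m₁ m₂)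
    (hcc' : ∀ m₁ m₂ n₁ n₂, c' m₁ m₂ n₁ n₂ = c n₁ n₂ m₁ m₂)
    (hr : ∀ n₁ n₂, Rapid (c n₁ n₂)) (hr' : ∀ n₁ n₂, Rapid (c' n₁ n₂))
    (hg : ∀ n₁ n₂ k₁ k₂ : ℕ, (n₁ ! * n₂ ! : ℝ) * (l ^ 2 * pairing (c n₁ n₂) (c k₁ k₂)) =
      if n₁ = k₁ ∧ n₂ = k₂ then 1 else 0)
    (hg' : ∀ n₁ n₂ k₁ k₂ : ℕ, (n₁ ! * n₂ ! : ℝ) * (l ^ 2 * pairing (c' n₁ n₂) (c' k₁ k₂)) =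
      if n₁ = k₁ ∧ n₂ = k₂ then 1 else 0) :
    ∃ U : TwoMode ≃ₗᵢ[ℂ] TwoMode, HasFockMatrix U T := by
  have hT' : ∀ m₁ m₂ n₁ n₂ : ℕ, T m₁ m₂ n₁ n₂ =
      l * √(n₁ ! * n₂ ! * (m₁ ! * m₂ !)) * c' m₁ m₂ n₁ n₂ := fun m₁ m₂ n₁ n₂ => by
    rw [hT, hcc', mul_comm (m₁ ! * m₂ ! : ℝ)]
  obtain ⟨U, hU⟩ := exists_unitary_of_orthonormal
    (fun m n : ℕ × ℕ => T m.1 m.2 n.1 n.2)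
    (fun n => by simpa only [hT] using summable_kernel l hr n)
    (fun n k => by simpa only [hT] using tsum_kernel l c hg n k)
    (fun m => by simpa only [hT'] using summable_kernel l hr' m)
    (fun m k => by simpa only [hT'] using tsum_kernel l c' hg' m k)
  refine ⟨U, fun m₁ m₂ n₁ n₂ => ?_⟩
  rw [ket₂, lp.inner_single_left, ket₂, hU]
  simp

/-! ### The dilation unitaries -/

theorem shift_apply (f : ℕ → ℕ → ℕ → ℝ) (n a b : ℕ) :
    shift f n a b = shift (fun n => f n a b) n := by
  cases n <;> rfl

/-- Inputs label the table rows and outputs its columns, with the output modes in reversed order.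
Row recursions thus act as multiplication and column recursions as differentiation. -/
theorem beamsplitterLadder_columns (k s : ℝ) :
    BeamsplitterLadder k s fun n₁ n₂ a b => tableSum s k k (-s) n₁ n₂ b a where
  zero a b := by simp [tableSum, and_comm, eq_comm]
  succ₁ n₁ n₂ := by
    funext a b
    exact (tableSum_succ_row₁ s k k (-s) n₁ n₂ b a).trans (add_comm _ _)
  succ₂ n₁ n₂ := by
    funext a b
    exact (tableSum_succ_row₂ s k k (-s) n₁ n₂ b a).trans (add_comm _ _)
  deriv₁ n₁ n₂ := by
    funext a b
    simpa [shift_apply, deriv₁] using tableSum_succ_col₂ s k k (-s) n₁ n₂ b a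
  deriv₂ n₁ n₂ := by
    funext a b
    simpa [shift_apply, deriv₂] using tableSum_succ_col₁ s k k (-s) n₁ n₂ b a

theorem beamsplitterLadder_rows (k s : ℝ) :
    BeamsplitterLadder k (-s) fun m₁ m₂ a b => tableSum s k k (-s) a b m₂ m₁ where
  zero a b := by
    have h : ∀ p : ℕ, ∀ i ∈ antidiagonal p, (i.1 = 0 ∧ i.2 = 0) → p = 0 := fun p i hi h => by
      have := mem_antidiagonal.1 hi
      omega
    by_cases hab : a = 0 ∧ b = 0
    · obtain ⟨rfl, rfl⟩ := hab
      simp [tableSum]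
    · rw [if_neg hab]
      refine sum_eq_zero fun i hi => sum_eq_zero fun j hj => if_neg fun hij => hab ?_
      have := mem_antidiagonal.1 hi
      have := mem_antidiagonal.1 hj
      omega
  succ₁ m₁ m₂ := by
    funext a b
    exact tableSum_succ_col₂ s k k (-s) a b m₂ m₁
  succ₂ m₁ m₂ := by
    funext a b
    simpa [shift_apply, mulX₁, mulX₂] using tableSum_succ_col₁ s k k (-s) a b m₂ m₁
  deriv₁ m₁ m₂ := by
    funext a b
    simpa [shift_apply, deriv₁, add_comm] using tableSum_succ_row₁ s k k (-s) a b m₂ m₁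
  deriv₂ m₁ m₂ := by
    funext a b
    simpa [shift_apply, deriv₂, add_comm] using tableSum_succ_row₂ s k k (-s) a b m₂ m₁

theorem tableSum_zero_row₁_col₁ (c₁ c₂ c₃ c₄ : ℝ) (q v : ℕ) :
    tableSum c₁ c₂ c₃ c₄ 0 q 0 v = if q = v then c₄ ^ q / q ! else 0 := by
  rw [tableSum, antidiagonal_zero, sum_singleton, sum_eq_single (0, q)]
  · simp
  · intro j hj hne
    refine if_neg fun h => hne ?_
    have := mem_antidiagonal.1 hj
    ext <;> simp <;> omega
  · simp

theorem tableSum_zero_row₂_col₂ (c₁ c₂ c₃ c₄ : ℝ) (p u : ℕ) :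
    tableSum c₁ c₂ c₃ c₄ p 0 u 0 = if p = u then c₁ ^ p / p ! else 0 := by
  rw [tableSum_swap_rows, tableSum_swap_cols, tableSum_zero_row₁_col₁]

/-- Here each side of the table carries one input and one output: rows `n₂, m₁`, columns `n₁, m₂`.
Hence every recursion mixes an input shift with an output operation. -/
theorem squeezerLadder_columns (l s : ℝ) :
    SqueezerLadder l s fun n₁ n₂ a b => tableSum (-s) l l s n₂ a n₁ b where
  zero a b := tableSum_zero_row₁_col₁ ..
  succ₁ n₁ n₂ := by
    funext a b
    simpa [shift_apply, mulX₁, add_comm] using tableSum_succ_col₁ (-s) l l s n₂ a n₁ b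
  succ₂ n₁ n₂ := by
    funext a b
    simpa [shift_apply, mulX₂, add_comm] using tableSum_succ_row₁ (-s) l l s n₂ a n₁ b
  deriv₁ n₁ n₂ := by
    funext a b
    simpa [shift_apply, mulX₂, deriv₁] using tableSum_succ_row₂ (-s) l l s n₂ a n₁ b
  deriv₂ n₁ n₂ := by
    funext a b
    simpa [shift_apply, mulX₁, deriv₂] using tableSum_succ_col₂ (-s) l l s n₂ a n₁ b

theorem squeezerLadder_rows (l s : ℝ) :
    SqueezerLadder l (-s) fun m₁ m₂ a b => tableSum (-s) l l s b m₁ a m₂ where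
  zero a b := by
    rw [tableSum_zero_row₂_col₂]
    by_cases h : a = b
    · simp [h]
    · simp [h, Ne.symm h]
  succ₁ m₁ m₂ := by
    funext a b
    simpa [shift_apply, mulX₁] using tableSum_succ_row₂ (-s) l l s b m₁ a m₂
  succ₂ m₁ m₂ := by
    funext a b
    simpa [shift_apply, mulX₂] using tableSum_succ_col₂ (-s) l l s b m₁ a m₂
  deriv₁ m₁ m₂ := by
    funext a b
    simpa [shift_apply, mulX₂, deriv₁, add_comm] using tableSum_succ_col₁ (-s) l l s b m₁ a m₂
  deriv₂ m₁ m₂ := by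
    funext a b
    simpa [shift_apply, mulX₁, deriv₂, add_comm] using tableSum_succ_row₁ (-s) l l s b m₁ a m₂

/-! ### Identification of the explicit matrix elements with table sums -/

theorem sqrt_div_mul_mul {x y : ℝ} (hx : 0 ≤ x) (hy : 0 < y) (z : ℝ) :
    √(x / y) * (y * z) = √(x * y) * z := by
  rw [Real.sqrt_div hx, Real.sqrt_mul hx]
  have h : √y ≠ 0 := (Real.sqrt_pos.2 hy).ne'
  field_simp
  rw [Real.sq_sqrt hy.le]

theorem attenuatorT_eq (κ : ℝ) (m₁ m₂ n₁ n₂ : ℕ) :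
    attenuatorT κ m₁ m₂ n₁ n₂ = √(m₁ ! * m₂ ! * (n₁ ! * n₂ !)) *
      tableSum √(1 - κ ^ 2) κ κ (-√(1 - κ ^ 2)) n₁ n₂ m₂ m₁ := by
  rw [← sqrt_div_mul_mul (by positivity) (by positivity), tableSum_eq_range, attenuatorT]
  congr 1
  refine sum_congr rfl fun r hr => sum_congr rfl fun j hj => ?_
  have hr' : r ≤ n₁ := Nat.lt_succ_iff.1 (mem_range.1 hr)
  have hj' : j ≤ n₂ := Nat.lt_succ_iff.1 (mem_range.1 hj)
  split_ifs with h
  · rw [show n₁ + j - r = n₁ - r + j by omega, show r + n₂ - j = r + (n₂ - j) by omega,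
      neg_pow √(1 - κ ^ 2)]
    ring
  · rfl

theorem amplifierT_eq (κ : ℝ) (m₁ m₂ n₁ n₂ : ℕ) :
    amplifierT κ m₁ m₂ n₁ n₂ = κ⁻¹ * √(m₁ ! * m₂ ! * (n₁ ! * n₂ !)) *
      tableSum (-√(1 - κ⁻¹ ^ 2)) κ⁻¹ κ⁻¹ √(1 - κ⁻¹ ^ 2) n₂ m₁ n₁ m₂ := by
  rw [show (m₁ ! * m₂ ! * (n₁ ! * n₂ !) : ℝ) = (n₁ ! * m₂ !) * (n₂ ! * m₁ !) by ring, mul_assoc,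
    ← sqrt_div_mul_mul (by positivity) (by positivity), tableSum_eq_range, amplifierT, mul_assoc,
    mul_comm (m₁ ! : ℝ)]
  congr 2
  refine sum_congr rfl fun r hr => sum_congr rfl fun j hj => ?_
  have hr' : r ≤ n₂ := Nat.lt_succ_iff.1 (mem_range.1 hr)
  have hj' : j ≤ m₁ := Nat.lt_succ_iff.1 (mem_range.1 hj)
  split_ifs with h
  · rw [show n₂ + j - r = n₂ - r + j by omega, show m₁ + r - j = r + (m₁ - j) by omega,
      neg_pow √(1 - κ⁻¹ ^ 2)]
    ring
  · rfl

/-- With amplifier parameter `μ = √(1 + κ²)` one has `√(1 - μ⁻²) = κ / μ`, where `0 ≤ κ` fixes the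
sign of the root; the two double sums then agree after exchanging the inputs. -/
theorem conjugatorT_eq (κ : ℝ) (hκ : 0 ≤ κ) (m₁ m₂ n₁ n₂ : ℕ) :
    conjugatorT κ m₁ m₂ n₁ n₂ = amplifierT √(1 + κ ^ 2) m₁ m₂ n₂ n₁ := by
  have hpos : 0 < 1 + κ ^ 2 := by positivity
  have hs : √(1 - (√(1 + κ ^ 2))⁻¹ ^ 2) = κ / √(1 + κ ^ 2) := by
    rw [← Real.sqrt_sq (show 0 ≤ κ / √(1 + κ ^ 2) by positivity), div_pow, inv_pow,
      Real.sq_sqrt hpos.le]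
    congr 1
    field_simp
    ring
  rw [conjugatorT, amplifierT, hs, sum_comm]
  congr 1
  refine sum_congr rfl fun r hr => sum_congr rfl fun j hj => ?_
  simp only [add_comm r j, add_right_comm m₂ r j]
  split_ifs <;> ring

theorem exists_unitary_attenuatorT {κ : ℝ} (h₀ : 0 ≤ κ) (h₁ : κ ≤ 1) :
    ∃ U : TwoMode ≃ₗᵢ[ℂ] TwoMode, HasFockMatrix U (attenuatorT κ) := by
  have hks : κ ^ 2 + √(1 - κ ^ 2) ^ 2 = 1 := by
    rw [Real.sq_sqrt (by nlinarith)]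
    ring
  have hc := beamsplitterLadder_columns κ √(1 - κ ^ 2)
  have hr := beamsplitterLadder_rows κ √(1 - κ ^ 2)
  refine exists_unitary_of_gram 1 _ _ _ (fun m₁ m₂ n₁ n₂ => ?_) (fun _ _ _ _ => rfl)
    hc.rapid hr.rapid (fun n₁ n₂ k₁ k₂ => ?_) (fun n₁ n₂ k₁ k₂ => ?_)
  · rw [attenuatorT_eq, one_mul]
  · rw [one_pow, one_mul]
    exact hc.gram hks ..
  · rw [one_pow, one_mul]
    exact hr.gram (by rwa [neg_sq]) ..

/-- The parameters `κ⁻¹` and `√(1 - κ⁻²)` of the amplifier. -/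
theorem amplifier_parameters {κ : ℝ} (h₁ : 1 ≤ κ) :
    κ⁻¹ ≠ 0 ∧ κ⁻¹ ^ 2 + √(1 - κ⁻¹ ^ 2) ^ 2 = 1 ∧ √(1 - κ⁻¹ ^ 2) ^ 2 < 1 := by
  have hl1 : κ⁻¹ ≤ 1 := inv_le_one_of_one_le₀ h₁
  have hl0 : 0 < κ⁻¹ := by positivity
  rw [Real.sq_sqrt (by nlinarith)]
  refine ⟨hl0.ne', by ring, by nlinarith⟩

theorem exists_unitary_amplifierT {κ : ℝ} (h₁ : 1 ≤ κ) :
    ∃ U : TwoMode ≃ₗᵢ[ℂ] TwoMode, HasFockMatrix U (amplifierT κ) := by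
  obtain ⟨hl, hls, hs⟩ := amplifier_parameters h₁
  have hc := squeezerLadder_columns κ⁻¹ √(1 - κ⁻¹ ^ 2)
  have hr := squeezerLadder_rows κ⁻¹ √(1 - κ⁻¹ ^ 2)
  exact exists_unitary_of_gram κ⁻¹ _ _ _ (amplifierT_eq κ) (fun _ _ _ _ => rfl)
    (hc.rapid hs) (hr.rapid (by rwa [neg_sq])) (hc.gram hls hl) (hr.gram (by rwa [neg_sq]) hl)

theorem exists_unitary_conjugatorT {κ : ℝ} (h₀ : 0 ≤ κ) :
    ∃ U : TwoMode ≃ₗᵢ[ℂ] TwoMode, HasFockMatrix U (conjugatorT κ) := by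
  set μ : ℝ := √(1 + κ ^ 2) with hμ
  have h₁ : 1 ≤ μ := Real.one_le_sqrt.2 (by nlinarith)
  obtain ⟨hl, hls, hs⟩ := amplifier_parameters h₁
  have hc := squeezerLadder_columns μ⁻¹ √(1 - μ⁻¹ ^ 2)
  have hr := squeezerLadder_rows μ⁻¹ √(1 - μ⁻¹ ^ 2)
  have hr' := hr.rapid (by rwa [neg_sq])
  have hg' := hr.gram (by rwa [neg_sq]) hl
  -- Exchanging the inputs permutes the columns and swaps the two variables of each row series,
  -- neither of which affects orthonormality.
  refine exists_unitary_of_gram μ⁻¹ _ (fun n₁ n₂ a b => tableSum _ _ _ _ n₁ a n₂ b)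
    (fun m₁ m₂ a b => tableSum _ _ _ _ a m₁ b m₂) (fun m₁ m₂ n₁ n₂ => ?_) (fun _ _ _ _ => rfl)
    (fun n₁ n₂ => hc.rapid hs n₂ n₁) (fun m₁ m₂ => (hr' m₁ m₂).swap) (fun n₁ n₂ k₁ k₂ => ?_)
    (fun m₁ m₂ k₁ k₂ => ?_)
  · rw [conjugatorT_eq κ h₀, ← hμ, amplifierT_eq, mul_comm (n₂ ! : ℝ)]
  · simpa only [mul_comm (n₁ ! : ℝ), and_comm] using hc.gram hls hl n₂ n₁ k₂ k₁
  · rw [← hg' m₁ m₂ k₁ k₂, ← pairing_swap]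

end PhotonAdded
end

noncomputable section

namespace PhotonAdded

open Finset

/-! ### Measure-and-prepare channels -/

theorem inner_ket_left (k : ℕ) (ψ : Mode) : inner ℂ (ket k) ψ = ψ k := by
  simp [ket, lp.inner_single_left]

theorem norm_ket (k : ℕ) : ‖ket k‖ = 1 := by
  rw [ket, lp.norm_single (by norm_num), norm_one]

/-- The diagonal Fock matrix element `⟨k| A |k⟩`. -/
def diag (A : TraceClass) (k : ℕ) : ℂ := A.1 (ket k) k

theorem summable_norm_coe_mul (u v : Mode) :
    Summable (fun k => ‖v k‖ * ‖u k‖) ∧ ∑' k, ‖v k‖ * ‖u k‖ ≤ ‖u‖ * ‖v‖ := by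
  have h2 : 0 < (2 : ℝ≥0∞).toReal := by norm_num
  have hs : ∀ w : Mode, Summable fun k => ‖w k‖ ^ (2 : ℝ) := fun w => by
    simpa using (memℓp_gen_iff h2).1 (lp.memℓp w)
  have hn : ∀ w : Mode, ‖w‖ = (∑' k, ‖w k‖ ^ (2 : ℝ)) ^ (1 / 2 : ℝ) := fun w => by
    simpa using lp.norm_eq_tsum_rpow h2 w
  have h := Real.summable_and_inner_le_Lp_mul_Lq_tsum_of_nonneg Real.HolderConjugate.two_two
    (fun k => norm_nonneg (v k)) (fun k => norm_nonneg (u k)) (hs v) (hs u)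
  rw [mul_comm, hn u, hn v]
  exact h

/-- Cauchy–Schwarz bounds the diagonal of each `|uᵢ⟩⟨vᵢ|` by `‖uᵢ‖ ‖vᵢ‖`; nonnegativity lets the two
summations be exchanged. -/
theorem summable_norm_diag (A : TraceClass) : Summable fun k => ‖diag A k‖ := by
  obtain ⟨u, v, hs, hA⟩ := A.2
  have hf : Summable fun p : ℕ × ℕ => ‖v p.1 p.2‖ * ‖u p.1 p.2‖ := by
    refine (summable_prod_of_nonneg fun p => by positivity).2
      ⟨fun i => (summable_norm_coe_mul (u i) (v i)).1, ?_⟩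
    exact Summable.of_nonneg_of_le (fun i => tsum_nonneg fun k => by positivity)
      (fun i => (summable_norm_coe_mul (u i) (v i)).2) hs
  refine Summable.of_nonneg_of_le (fun k => norm_nonneg _) (fun k => ?_) hf.prod_symm.prod
  have h := (hA (ket k)).mapL (innerSL ℂ (ket k))
  simp only [innerSL_apply_apply, inner_ket_left] at h
  refine h.norm_le_of_bounded (hf.prod_symm.prod_factor k).hasSum fun i => ?_
  rw [lp.coeFn_smul, Pi.smul_apply, norm_smul, norm_inner_symm, inner_ket_left]
  rfl

theorem summable_diag_rankOne (g : ℕ → ℕ) (A : TraceClass) :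
    Summable fun k => diag A k • InnerProductSpace.rankOne ℂ (ket (g k)) (ket (g k)) := by
  refine Summable.of_norm_bounded (summable_norm_diag A) fun k => ?_
  simp [norm_smul, norm_ket]

theorem isNuclearRep_measurePrepare (g : ℕ → ℕ) (A : TraceClass) :
    IsNuclearRep (∑' k, diag A k • InnerProductSpace.rankOne ℂ (ket (g k)) (ket (g k)))
      (fun k => diag A k • ket (g k)) (fun k => ket (g k)) := by
  refine ⟨by simpa [norm_smul, norm_ket] using summable_norm_diag A, fun ψ => ?_⟩
  have h := (summable_diag_rankOne g A).hasSum.mapL (ContinuousLinearMap.apply ℂ Mode ψ)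
  refine h.congr_fun fun k => ?_
  simp [smul_comm (diag A k)]

/-- The channel that measures in the Fock basis and prepares `|g k⟩` upon the outcome `k`. -/
def measurePrepare (g : ℕ → ℕ) : TraceClass →ₗ[ℂ] TraceClass where
  toFun A := ⟨_, _, _, isNuclearRep_measurePrepare g A⟩
  map_add' A B := by
    ext1
    change ∑' k, diag (A + B) k • _ = (∑' k, diag A k • _) + ∑' k, diag B k • _
    rw [← (summable_diag_rankOne g A).tsum_add (summable_diag_rankOne g B)]
    exact tsum_congr fun k => add_smul (diag A k) (diag B k) _
  map_smul' c A := by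
    ext1
    change ∑' k, diag (c • A) k • _ = c • ∑' k, diag A k • _
    rw [← (summable_diag_rankOne g A).tsum_const_smul]
    exact tsum_congr fun k => mul_smul c (diag A k) _

theorem hasSum_measurePrepare (g : ℕ → ℕ) (A : TraceClass) (φ ψ : Mode) :
    HasSum (fun k => diag A k * (star (φ (g k)) * ψ (g k)))
      (inner ℂ φ ((measurePrepare g A).1 ψ)) := by
  refine (((isNuclearRep_measurePrepare g A).2 ψ).mapL (innerSL ℂ φ)).congr_fun fun k => ?_
  rw [innerSL_apply_apply, inner_smul_right, inner_smul_right, inner_ket_left, ← inner_conj_symm,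
    inner_ket_left]
  simp only [starRingEnd_apply]
  ring

theorem isChannel_measurePrepare (g : ℕ → ℕ) : IsChannel (measurePrepare g) where
  completelyPositive N ρ hρ ψ := by
    have h : HasSum (fun k => ∑ i, ∑ j, diag (ρ i j) k * (star (ψ i (g k)) * ψ j (g k)))
        (∑ i, ∑ j, inner ℂ (ψ i) ((measurePrepare g (ρ i j)).1 (ψ j))) :=
      hasSum_sum fun i _ => hasSum_sum fun j _ => hasSum_measurePrepare g (ρ i j) (ψ i) (ψ j)
    refine h.nonneg fun k => ?_
    -- Testing block positivity on the vectors `ψ i (g k) • ket k` yields exactly the `k`-th term of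
    -- the series.
    have hk := hρ fun i => ψ i (g k) • ket k
    simp only [map_smul, inner_smul_left, inner_smul_right, inner_ket_left] at hk
    refine hk.trans_eq (sum_congr rfl fun i _ => sum_congr rfl fun j _ => ?_)
    simp only [diag, starRingEnd_apply]
    ring
  tracePreserving A := by
    have hinj : Function.Injective fun k : ℕ => (g k, k) := fun a b h => (Prod.ext_iff.1 h).2
    -- The double family lives on the graph of `g`, where it is the absolutely summable diagonal of
    -- `A`; this justifies exchanging the sums in the trace.
    have hs : Summable fun p : ℕ × ℕ => if g p.2 = p.1 then diag A p.2 else 0 := by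
      refine (hinj.summable_iff fun p hp => if_neg fun h => hp ⟨p.2, Prod.ext h rfl⟩).1 ?_
      exact (summable_norm_diag A).of_norm.congr fun k => by simp
    have h1 : ∀ l, inner ℂ (ket l) ((measurePrepare g A).1 (ket l)) =
        ∑' k, if g k = l then diag A k else 0 := fun l => by
      refine (hasSum_measurePrepare g A (ket l) (ket l)).tsum_eq.symm.trans
        (tsum_congr fun k => ?_)
      by_cases h : g k = l
      · simp [h, ket]
      · simp [h, ket]
    simp only [trace, h1]
    refine (Summable.tsum_comm (f := fun l k => if g k = l then diag A k else 0) hs).symm.trans ?_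
    refine tsum_congr fun k => ?_
    rw [inner_ket_left, tsum_eq_single (g k) fun l hl => if_neg hl.symm, if_pos rfl]
    rfl

theorem hasSum_norm_sq (φ : Mode) : HasSum (fun k => ‖φ k‖ ^ 2) (‖φ‖ ^ 2) := by
  have h := lp.hasSum_norm (by norm_num : 0 < (2 : ℝ≥0∞).toReal) φ
  simpa using h

/-- If `g` recovers `x` from every Fock state that occurs in `F φ`, then `measurePrepare g` maps
`F |φ⟩⟨φ| F†` to a multiple of `|x⟩⟨x|`. -/
theorem measurePrepare_conj_proj (g : ℕ → ℕ) (F : Mode →L[ℂ] Mode) (φ : Mode) (x : ℕ)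
    (h : ∀ k, F φ k ≠ 0 → g k = x) :
    measurePrepare g (conj F (proj φ)) = ((‖F φ‖ ^ 2 : ℝ) : ℂ) • proj (ket x) := by
  have hd : ∀ k, diag (conj F (proj φ)) k = ((‖F φ k‖ ^ 2 : ℝ) : ℂ) := fun k => by
    have : diag (conj F (proj φ)) k = inner ℂ φ (F.adjoint (ket k)) * F φ k := by
      simp [diag, conj, proj]
    rw [this, ContinuousLinearMap.adjoint_inner_right, ← inner_conj_symm, inner_ket_left,
      mul_comm, Complex.mul_conj, Complex.normSq_eq_norm_sq]
  ext1
  refine HasSum.tsum_eq ?_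
  have h1 : HasSum (fun k => ((‖F φ k‖ ^ 2 : ℝ) : ℂ) • (proj (ket x)).1)
      (((‖F φ‖ ^ 2 : ℝ) : ℂ) • (proj (ket x)).1) :=
    (Complex.hasSum_ofReal.2 (hasSum_norm_sq (F φ))).smul_const _
  refine h1.congr_fun fun k => ?_
  rw [hd]
  by_cases hk : F φ k = 0
  · simp [hk]
  · rw [h k hk]
    rfl

theorem traceNorm_smul_proj_ket_le (c : ℂ) (x : ℕ) :
    traceNorm (c • proj (ket x) : TraceClass).1 ≤ ENNReal.ofReal ‖c‖ := by
  refine ((iInf₂_le _ _).trans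
    (iInf_le _ ((IsNuclearRep.rankOne (ket x) (ket x)).smul c))).trans ?_
  refine ENNReal.ofReal_le_ofReal ?_
  rw [tsum_eq_single (0 : ℕ) fun k hk => by simp [Pi.single_eq_of_ne hk]]
  simp [norm_smul, norm_ket]

/-! ### Correction of the Fock basis -/

theorem envKet_ket (n x : ℕ) : envKet n (ket x) = ket₂ x n := by
  ext p
  have h : ∀ ψ : TwoMode, ψ p = inner ℂ (ket₂ p.1 p.2) ψ := fun ψ => by
    simp [ket₂, lp.inner_single_left]
  rw [h, h, envKet, ContinuousLinearMap.adjoint_inner_right, ← inner_conj_symm, inner_ket_left,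
    ket₂, ket₂, lp.inner_single_left]
  change star (ket₂ p.1 p.2 (x, n)) = _
  by_cases hp : (x, n) = p
  · subst hp; simp [ket₂]
  · simp [ket₂, hp, Ne.symm hp]

theorem kraus_ket_apply {U : TwoMode ≃ₗᵢ[ℂ] TwoMode} {T : ℕ → ℕ → ℕ → ℕ → ℝ}
    (hU : HasFockMatrix U T) (n y x a : ℕ) : kraus U n y (ket x) a = (T a y x n : ℂ) := by
  rw [← hU, ket₂, lp.inner_single_left]
  change U (envKet n (ket x)) (a, y) = _
  rw [envKet_ket]
  simp

/-- The vectors `F_y |x⟩` are the environment slices of the unit vector `U |x, n⟩`. -/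
theorem hasSum_norm_sq_kraus_ket (U : TwoMode ≃ₗᵢ[ℂ] TwoMode) (n x : ℕ) :
    HasSum (fun y => ‖kraus U n y (ket x)‖ ^ 2) 1 := by
  have h := lp.hasSum_norm (by norm_num : 0 < (2 : ℝ≥0∞).toReal) (U (ket₂ x n))
  rw [U.norm_map, ket₂, lp.norm_single (by norm_num), norm_one, Real.one_rpow] at h
  refine ((Equiv.prodComm ℕ ℕ).hasSum_iff.2 h).prod_fiberwise fun y => ?_
  refine (hasSum_norm_sq (kraus U n y (ket x))).congr_fun fun a => ?_
  change _ = ‖U (envKet n (ket x)) (a, y)‖ ^ 2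
  rw [envKet_ket]
  simp [ket₂]

/-- The Fock basis is correctable if the outcome `y` of the measurement of the environment and the
Fock number of the output determine the Fock number of the input. -/
theorem fockCorrectable_of_decoder {U : TwoMode ≃ₗᵢ[ℂ] TwoMode} {T : ℕ → ℕ → ℕ → ℕ → ℝ}
    (hU : HasFockMatrix U T) (n : ℕ) (g : ℕ → ℕ → ℕ)
    (hg : ∀ a y x, T a y x n ≠ 0 → g y a = x) : FockCorrectable (kraus U n) := by
  refine ⟨fun y => measurePrepare (g y), fun y => isChannel_measurePrepare _, fun x => ?_⟩
  -- Every partial sum is a multiple of the target state, so trace-norm convergence reduces to that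
  -- of the scalar weights.
  have h : ∀ s : Finset ℕ, ∑ y ∈ s, measurePrepare (g y) (conj (kraus U n y) (proj (ket x))) -
      proj (ket x) = ((∑ y ∈ s, ‖kraus U n y (ket x)‖ ^ 2 - 1 : ℝ) : ℂ) • proj (ket x) := by
    intro s
    have hy : ∀ y, measurePrepare (g y) (conj (kraus U n y) (proj (ket x))) =
        ((‖kraus U n y (ket x)‖ ^ 2 : ℝ) : ℂ) • proj (ket x) := fun y => by
      refine measurePrepare_conj_proj _ _ _ _ fun a ha => hg a y x fun h0 => ha ?_
      rw [kraus_ket_apply hU, h0, Complex.ofReal_zero]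
    simp only [hy]
    rw [← Finset.sum_smul, Complex.ofReal_sub, Complex.ofReal_sum, Complex.ofReal_one]
    module
  have hlim : Filter.Tendsto (fun s : Finset ℕ => ENNReal.ofReal
      ‖((∑ y ∈ s, ‖kraus U n y (ket x)‖ ^ 2 - 1 : ℝ) : ℂ)‖) Filter.atTop (nhds 0) := by
    have h1 : Filter.Tendsto (fun s : Finset ℕ => ∑ y ∈ s, ‖kraus U n y (ket x)‖ ^ 2 - 1)
        Filter.atTop (nhds 0) := by
      simpa using (hasSum_norm_sq_kraus_ket U n x).sub_const 1
    simpa only [Complex.norm_real, norm_zero, ENNReal.ofReal_zero] using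
      ENNReal.tendsto_ofReal h1.norm
  refine tendsto_of_tendsto_of_tendsto_of_le_of_le tendsto_const_nhds hlim
    (fun _ => bot_le) fun s => ?_
  simp only [h]
  exact traceNorm_smul_proj_ket_le _ x

/-! ### Selection rules from the Kronecker deltas -/

theorem add_eq_of_attenuatorT_ne_zero {κ : ℝ} {m₁ m₂ n₁ n₂ : ℕ}
    (h : attenuatorT κ m₁ m₂ n₁ n₂ ≠ 0) : m₁ + m₂ = n₁ + n₂ := by
  contrapose! h
  refine mul_eq_zero_of_right _ (sum_eq_zero fun r _ => sum_eq_zero fun j _ => if_neg ?_)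
  omega

theorem add_eq_of_amplifierT_ne_zero {κ : ℝ} {m₁ m₂ n₁ n₂ : ℕ}
    (h : amplifierT κ m₁ m₂ n₁ n₂ ≠ 0) : m₁ + n₂ = n₁ + m₂ := by
  contrapose! h
  refine mul_eq_zero_of_right _ (sum_eq_zero fun r _ => sum_eq_zero fun j _ => if_neg ?_)
  omega

theorem add_eq_of_conjugatorT_ne_zero {κ : ℝ} {m₁ m₂ n₁ n₂ : ℕ}
    (h : conjugatorT κ m₁ m₂ n₁ n₂ ≠ 0) : m₁ + n₁ = n₂ + m₂ := by
  contrapose! h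
  refine mul_eq_zero_of_right _ (sum_eq_zero fun r _ => sum_eq_zero fun j _ => if_neg ?_)
  omega

end PhotonAdded
end

theorem mainTheorem6 (n : ℕ) :
    (∀ κ : ℝ, 0 ≤ κ → κ ≤ 1 → ∃ U : PhotonAdded.TwoMode ≃ₗᵢ[ℂ] PhotonAdded.TwoMode,
      PhotonAdded.HasFockMatrix U (PhotonAdded.attenuatorT κ) ∧
        PhotonAdded.FockCorrectable (PhotonAdded.kraus U n)) ∧
    (∀ κ : ℝ, 1 ≤ κ → ∃ U : PhotonAdded.TwoMode ≃ₗᵢ[ℂ] PhotonAdded.TwoMode,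
      PhotonAdded.HasFockMatrix U (PhotonAdded.amplifierT κ) ∧
        PhotonAdded.FockCorrectable (PhotonAdded.kraus U n)) ∧
    (∀ κ : ℝ, 0 ≤ κ → ∃ U : PhotonAdded.TwoMode ≃ₗᵢ[ℂ] PhotonAdded.TwoMode,
      PhotonAdded.HasFockMatrix U (PhotonAdded.conjugatorT κ) ∧
        PhotonAdded.FockCorrectable (PhotonAdded.kraus U n)) := by
  refine ⟨fun κ h₀ h₁ => ?_, fun κ h₁ => ?_, fun κ h₀ => ?_⟩
  · obtain ⟨U, hU⟩ := PhotonAdded.exists_unitary_attenuatorT h₀ h₁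
    -- The decoder solves the selection rule for `x`. Truncated subtraction is harmless: where the
    -- matrix element is nonzero, `a + y = x + n`, and other values of the decoder are irrelevant.
    refine ⟨U, hU, PhotonAdded.fockCorrectable_of_decoder hU n (fun y a => a + y - n) ?_⟩
    intro a y x h
    have := PhotonAdded.add_eq_of_attenuatorT_ne_zero h
    omega
  · obtain ⟨U, hU⟩ := PhotonAdded.exists_unitary_amplifierT h₁
    refine ⟨U, hU, PhotonAdded.fockCorrectable_of_decoder hU n (fun y a => a + n - y) ?_⟩
    intro a y x h
    have := PhotonAdded.add_eq_of_amplifierT_ne_zero h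
    omega
  · obtain ⟨U, hU⟩ := PhotonAdded.exists_unitary_conjugatorT h₀
    refine ⟨U, hU, PhotonAdded.fockCorrectable_of_decoder hU n (fun y a => y + n - a) ?_⟩
    intro a y x h
    have := PhotonAdded.add_eq_of_conjugatorT_ne_zero h
    omega
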